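/- Let $f_1,f_2:\mathbb R^n\to\mathbb R$ be convex and continuously differentiable with locally Lipschitz continuous gradients, let $g_1,g_2:\mathbb R^n\to\mathbb R\cup\{+\infty\}$ be proper, lower semicontinuous and convex, and put $\varphi_i=f_i+g_i$ for $i=1,2$. Let $X_2=\operatorname{argmin}_{\mathbb R^n}\varphi_2$ and $X_1=\operatorname{argmin}_{X_2}\varphi_1$, the set of solutions of the bilevel problem of minimizing $\varphi_1$ over $X_2$ (minimizers are understood to have a finite value). Assume that $\inf_{x\in\operatorname{dom}g_2}\varphi_1(x)>-\infty$ and that $X_1$ is nonempty and compact. For $\sigma>0$ write $f_\sigma=\sigma f_1+f_2$ and $g_\sigma=\sigma g_1+g_2$, and for $\alpha>0$ let $T_{\sigma,\alpha}(x)=\operatorname{prox}_{\alpha g_\sigma}(x-\alpha\nabla f_\sigma(x))$, where $\operatorname{prox}_{\alpha g}(y)=\operatorname{argmin}_w\{g(w)+\frac1{2\alpha}\|w-y\|^2\}$. Let $\nu\in(0,1)$ and let $(\sigma_k)_{k\ge0}$ satisfy $\sigma_0>0$, $\sigma_{k+1}\in[\frac34\sigma_k,\sigma_k]$ for all $k$,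 $\sigma_k\to0$, $\sum_k\sigma_k=\infty$ and $\sigma_{k+1}/\sigma_k\to1$. Set $\sigma_{-1}=\sigma_0$. For differentiable $F$ and $u,v\in\mathbb R^n$ let $$\ell_F(u,v)=\frac{\langle\nabla F(u)-\nabla F(v),u-v\rangle}{\|u-v\|^2},\qquad c_F(u,v)=\frac{\|\nabla F(u)-\nabla F(v)\|^2}{\langle\nabla F(u)-\nabla F(v),u-v\rangle}\qquad(\text{with }0/0=0).$$ (1) adaBiM. Let $x^{-1}\in\mathbb R^n$, $\alpha_0\ge\alpha_{-1}>0$, $\alpha_{\max}>0$ and $\eta\in(0,1)$. Put $x^0=T_{\sigma_0,\alpha_0}(x^{-1})$ and, for $k=0,1,2,\dots$, with $\rho_k=\frac{\sigma_k\alpha_k}{\sigma_{k-1}\alpha_{k-1}}$, $\ell_k=\ell_{f_{\sigma_k}}(x^{k-1},x^k)$, $c_k=c_{f_{\sigma_k}}(x^{k-1},x^k)$ and $\ell_k^{(2)}=\ell_{f_2}(x^{k-1},x^k)$, let $$\bar\alpha_{k+1}=\min\left\{\sqrt{\tfrac{\sigma_k}{\sigma_{k-1}}(1+\rho_k)}\,\tfrac{\sigma_k}{\sigma_{k+1}}\alpha_k,\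 \frac{\sqrt{1-4\left(1-\frac{\sigma_k}{\sigma_{k-1}}\right)\alpha_k\ell_k^{(2)}}}{2\sqrt{\alpha_k\ell_k\max\{\alpha_kc_k-1,0\}}}\,\tfrac{\sigma_k}{\sigma_{k+1}}\alpha_k,\ \alpha_{\max}\right\},$$ where the second term is $+\infty$ if its denominator vanishes; let $\alpha_{k+1}$ be the largest $a\in\{\bar\alpha_{k+1}\eta^i: i\in\mathbb N\}$ such that $z=T_{\sigma_{k+1},a}(x^k)$ satisfies $a\,\ell_{f_{\sigma_{k+1}}}(x^k,z)\le\nu$, and let $x^{k+1}=T_{\sigma_{k+1},\alpha_{k+1}}(x^k)$. Then this procedure is well defined, the sequence $(x^k)$ is bounded, all its cluster points belong to $X_1$, and $\operatorname{dist}(x^k,X_1)\to0$. (2) staBiM. Suppose in addition that $\nabla f_i$ is (globally) $L_i$-Lipschitz continuous, $i=1,2$, where $L_1,L_2\ge0$ and $L_1+L_2>0$. Let $x^0\in\mathbb R^n$ and, for $k=0,1,2,\dots$, let $x^{k+1}=T_{\sigma_{k+1},\alpha_{k+1}}(x^k)$ with $\alpha_{k+1}=\frac{\nu}{\sigma_{k+1}L_1+L_2}$.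 Then this sequence is well defined and bounded, all its cluster points belong to $X_1$, and $\operatorname{dist}(x^k,X_1)\to0$. -/

import Mathlib

open Filter Topology
open scoped Gradient NNReal

noncomputable section

/-- Extended-real-valued convexity: `h` takes values in `ℝ ∪ {+∞}`, is not identically `+∞`, is
lower semicontinuous and convex. -/
structure ProperLscConvex {n : ℕ} (h : EuclideanSpace ℝ (Fin n) → EReal) : Prop where
  ne_bot : ∀ x, h x ≠ ⊥
  dom_nonempty : ∃ x, h x < ⊤
  lsc : LowerSemicontinuous h
  convex : ∀ x y, ∀ a b : ℝ, 0 < a → 0 < b → a + b = 1 →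
    h (a • x + b • y) ≤ (a : EReal) * h x + (b : EReal) * h y

/-- The set of minimizers of `h` on `S`, with the usual convention that minimizers have a finite
value (`argmin` of the constant `+∞` is empty). -/
def argminOn {n : ℕ} (h : EuclideanSpace ℝ (Fin n) → EReal)
    (S : Set (EuclideanSpace ℝ (Fin n))) : Set (EuclideanSpace ℝ (Fin n)) :=
  {x | x ∈ S ∧ h x < ⊤ ∧ IsMinOn h S x}

/-- `p = prox_{α h}(y)`, that is, `p` minimizes `h(w) + ‖w - y‖² / (2 α)` over all `w`
(used with `α > 0`). -/
def IsProx {n : ℕ} (α : ℝ) (h : EuclideanSpace ℝ (Fin n) → EReal)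
    (y p : EuclideanSpace ℝ (Fin n)) : Prop :=
  p ∈ argminOn (fun w => h w + ((‖w - y‖ ^ 2 / (2 * α) : ℝ) : EReal)) Set.univ

/-- The Lipschitz estimate `⟨∇F(u) - ∇F(v), u - v⟩ / ‖u - v‖²` (with `0 / 0 = 0`). -/
def lipEst {n : ℕ} (F : EuclideanSpace ℝ (Fin n) → ℝ) (u v : EuclideanSpace ℝ (Fin n)) : ℝ :=
  inner ℝ (∇ F u - ∇ F v) (u - v) / ‖u - v‖ ^ 2

/-- The inverse cocoercivity estimate `‖∇F(u) - ∇F(v)‖² / ⟨∇F(u) - ∇F(v), u - v⟩`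
(with `0 / 0 = 0`). -/
def cocoEst {n : ℕ} (F : EuclideanSpace ℝ (Fin n) → ℝ) (u v : EuclideanSpace ℝ (Fin n)) : ℝ :=
  ‖∇ F u - ∇ F v‖ ^ 2 / inner ℝ (∇ F u - ∇ F v) (u - v)

/-- `prev a u k` is `u (k - 1)`, where `a` plays the role of `u (-1)`. -/
def prev {β : Type*} (a : β) (u : ℕ → β) : ℕ → β
  | 0 => a
  | k + 1 => u k

/-- The data of the bilevel problem: minimize `f₁ + g₁` over the set of minimizers of `f₂ + g₂`. -/
structure BilevelProblem (n : ℕ) where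
  f₁ : EuclideanSpace ℝ (Fin n) → ℝ
  f₂ : EuclideanSpace ℝ (Fin n) → ℝ
  g₁ : EuclideanSpace ℝ (Fin n) → EReal
  g₂ : EuclideanSpace ℝ (Fin n) → EReal

namespace BilevelProblem

/-- The upper level cost. -/
def cost₁ {n : ℕ} (P : BilevelProblem n) (x : EuclideanSpace ℝ (Fin n)) : EReal :=
  (P.f₁ x : EReal) + P.g₁ x

/-- The lower level cost. -/
def cost₂ {n : ℕ} (P : BilevelProblem n) (x : EuclideanSpace ℝ (Fin n)) : EReal :=
  (P.f₂ x : EReal) + P.g₂ x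

/-- The solutions of the lower level problem. -/
def X₂ {n : ℕ} (P : BilevelProblem n) : Set (EuclideanSpace ℝ (Fin n)) :=
  argminOn P.cost₂ Set.univ

/-- The solutions of the bilevel problem. -/
def X₁ {n : ℕ} (P : BilevelProblem n) : Set (EuclideanSpace ℝ (Fin n)) :=
  argminOn P.cost₁ P.X₂

/-- The basic requirements on the problem. -/
structure BasicAssumption {n : ℕ} (P : BilevelProblem n) : Prop where
  f₁_convex : ConvexOn ℝ Set.univ P.f₁
  f₂_convex : ConvexOn ℝ Set.univ P.f₂
  f₁_contDiff : ContDiff ℝ 1 P.f₁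
  f₂_contDiff : ContDiff ℝ 1 P.f₂
  f₁_locallyLipschitz : LocallyLipschitz (∇ P.f₁)
  f₂_locallyLipschitz : LocallyLipschitz (∇ P.f₂)
  g₁_proper : ProperLscConvex P.g₁
  g₂_proper : ProperLscConvex P.g₂
  cost₁_lower : ⊥ < ⨅ x ∈ {x | P.g₂ x < ⊤}, P.cost₁ x
  X₁_nonempty : P.X₁.Nonempty
  X₁_compact : IsCompact P.X₁

/-- The smooth part `f_σ = σ f₁ + f₂` of the inversely penalized cost. -/
def f {n : ℕ} (P : BilevelProblem n) (σ : ℝ) (x : EuclideanSpace ℝ (Fin n)) : ℝ :=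
  σ * P.f₁ x + P.f₂ x

/-- The nonsmooth part `g_σ = σ g₁ + g₂` of the inversely penalized cost. -/
def g {n : ℕ} (P : BilevelProblem n) (σ : ℝ) (x : EuclideanSpace ℝ (Fin n)) : EReal :=
  (σ : EReal) * P.g₁ x + P.g₂ x

/-- `z = prox_{α g_σ}(x - α ∇f_σ(x))`: one proximal gradient step from `x` to `z`. -/
def IsProxGradStep {n : ℕ} (P : BilevelProblem n) (σ α : ℝ)
    (x z : EuclideanSpace ℝ (Fin n)) : Prop :=
  IsProx α (P.g σ) (x - α • ∇ (P.f σ) x) z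

/-- The initial trial stepsize of adaBiM, computed from
`σp = σ_{k-1}`, `σ = σ_k`, `σn = σ_{k+1}`, `αp = α_{k-1}`, `α = α_k`, `xp = x^{k-1}`, `x = x^k`.
The second term of the minimum is `+∞`, hence dropped, when its denominator vanishes. -/
def trialStepsize {n : ℕ} (P : BilevelProblem n) (αmax σp σ σn αp α : ℝ)
    (xp x : EuclideanSpace ℝ (Fin n)) : ℝ :=
  let ρ := (σ * α) / (σp * αp)
  let ℓ := lipEst (P.f σ) xp x
  let ℓ₂ := lipEst P.f₂ xp x
  let c := cocoEst (P.f σ) xp x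
  let t₁ := √(σ / σp * (1 + ρ)) * (σ / σn) * α
  let d := 2 * √(α * ℓ * max (α * c - 1) 0)
  let t₂ := √(1 - 4 * (1 - σ / σp) * (α * ℓ₂)) / d * (σ / σn) * α
  if d = 0 then min t₁ αmax else min t₁ (min t₂ αmax)

/-- `(x, α)` are the iterates `x^0, x^1, …` and stepsizes `α_0, α_1, …` of adaBiM with inverse
penalties `σ`, starting point `xinit = x^{-1}`, initial stepsizes `αinit = α_{-1}` and `α₀`, and
`σ_{-1} = σ_0`. Each `α_{k+1}` is the largest element of `{ᾱ_{k+1} ηⁱ | i ∈ ℕ}` for which the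
resulting proximal gradient step passes the linesearch test. -/
structure IsAdaBiM {n : ℕ} (P : BilevelProblem n) (η ν αmax : ℝ) (σ : ℕ → ℝ)
    (xinit : EuclideanSpace ℝ (Fin n)) (αinit α₀ : ℝ)
    (x : ℕ → EuclideanSpace ℝ (Fin n)) (α : ℕ → ℝ) : Prop where
  α_zero : α 0 = α₀
  x_zero : P.IsProxGradStep (σ 0) (α 0) xinit (x 0)
  α_succ : ∀ k : ℕ, IsGreatest
    {a : ℝ | (∃ i : ℕ, a = P.trialStepsize αmax (prev (σ 0) σ k) (σ k) (σ (k + 1))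
        (prev αinit α k) (α k) (prev xinit x k) (x k) * η ^ i) ∧
      ∃ z, P.IsProxGradStep (σ (k + 1)) a (x k) z ∧
        a * lipEst (P.f (σ (k + 1))) (x k) z ≤ ν}
    (α (k + 1))
  x_succ : ∀ k : ℕ, P.IsProxGradStep (σ (k + 1)) (α (k + 1)) (x k) (x (k + 1))

/-- `x` are the iterates of staBiM with starting point `x₀`, inverse penalties `σ` and Lipschitz
moduli `L₁`, `L₂` of the gradients of `f₁`, `f₂`. -/
structure IsStaBiM {n : ℕ} (P : BilevelProblem n) (ν L₁ L₂ : ℝ) (σ : ℕ → ℝ)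
    (x₀ : EuclideanSpace ℝ (Fin n)) (x : ℕ → EuclideanSpace ℝ (Fin n)) : Prop where
  x_zero : x 0 = x₀
  x_succ : ∀ k : ℕ,
    P.IsProxGradStep (σ (k + 1)) (ν / (σ (k + 1) * L₁ + L₂)) (x k) (x (k + 1))

/-- `x` is bounded, all its cluster points solve the bilevel problem, and its distance to the set
of solutions converges to zero. -/
structure ConvergesToSolutions {n : ℕ} (P : BilevelProblem n)
    (x : ℕ → EuclideanSpace ℝ (Fin n)) : Prop where
  bounded : Bornology.IsBounded (Set.range x)
  cluster : ∀ z, MapClusterPt z atTop x → z ∈ P.X₁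
  dist_tendsto : Tendsto (fun k => Metric.infDist (x k) P.X₁) atTop (𝓝 0)

end BilevelProblem

/-- The inverse penalties: `σ_0 > 0` and `σ_{k+1} ∈ [3/4 σ_k, σ_k]`, as both algorithms choose
them, together with `σ_k → 0`, `∑ σ_k = ∞` and `σ_{k+1} / σ_k → 1`. -/
structure IsPenaltySeq (σ : ℕ → ℝ) : Prop where
  pos : 0 < σ 0
  mem : ∀ k, σ (k + 1) ∈ Set.Icc (3 / 4 * σ k) (σ k)
  tendsto_zero : Tendsto σ atTop (𝓝 0)
  sum_eq_top : Tendsto (fun m => ∑ k ∈ Finset.range m, σ k) atTop atTop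
  ratio : Tendsto (fun k => σ (k + 1) / σ k) atTop (𝓝 1)

end

/-! Both algorithms fit one scheme, `EnergyDecrease`. For every solution `xs` there is an energy
that dominates half the squared distance to `xs`. At each step it loses at least `τ (σ (φ₁(y) -
φ₁(xs)) + φ₂(y) - φ₂(xs))`, where `y` is an iterate, and after the step it is small whenever `y` is
close to `xs` and the error `ω` is small. The lower level gap is never negative, so the energy can
grow only when `φ₁(y) < φ₁(xs)`. Such a `y` lies in a joint level set of the two costs. Convexity
and compactness of `X₁` make these level sets bounded, and close to `X₁` when both bounds are close
to optimal.

Boundedness follows from this dichotomy (`exists_bound`). The penalized gap `σ (φ₁ - m) + (φ₂ - min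
φ₂)`, with `m` a lower bound of `φ₁`, is nonincreasing and tends to 0, since otherwise the energy
would become negative; hence `φ₂(y) → min φ₂` (`tendsto_gap`). Since `∑ σ_k = ∞`, the upper level
gap cannot stay above a positive constant. So at some time the energy from a nearby solution is
small, and the dichotomy keeps it small, with a change of solution where needed (`tendsto_infDist`).

For staBiM the energy is half the squared distance, by the descent lemma. For adaBiM it also
contains the last displacement and a multiple of the penalized gap (`energyDecrease`). Its decrease
combines two consecutive proximal inequalities (`IsProxGradStep.energy_le`) with the second stepsize
bound. The iterates are then bounded, local Lipschitz moduli become uniform, and the stepsizes stay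
away from zero (`exists_le_α`). -/

/-! ### Gradients of convex functions. -/

section Smooth

variable {E : Type*} [NormedAddCommGroup E] [InnerProductSpace ℝ E] [CompleteSpace E]

theorem hasDerivAt_comp_lineMap_gradient {f : E → ℝ} (hf : Differentiable ℝ f) (x d : E) (t : ℝ) :
    HasDerivAt (fun s : ℝ => f (x + s • d)) (inner ℝ (∇ f (x + t • d)) d) t := by
  have h1 : HasFDerivAt f (fderiv ℝ f (x + t • d)) (x + t • d) := (hf _).hasFDerivAt
  have h2 : HasDerivAt (fun s : ℝ => x + s • d) d t := by
    simpa using ((hasDerivAt_id t).smul_const d).const_add x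
  have h3 := h1.comp_hasDerivAt t h2
  rw [inner_gradient_left]
  exact h3

/-- The gradient inequality for differentiable convex functions. -/
theorem ConvexOn.add_inner_gradient_le {f : E → ℝ} (hc : ConvexOn ℝ Set.univ f)
    (hf : Differentiable ℝ f) (x y : E) : f x + inner ℝ (∇ f x) (y - x) ≤ f y := by
  have hd := hasDerivAt_comp_lineMap_gradient hf x (y - x) 0
  have hconv : ConvexOn ℝ Set.univ (fun s : ℝ => f (x + s • (y - x))) := by
    have := hc.comp_affineMap (AffineMap.lineMap x y : ℝ →ᵃ[ℝ] E)
    have he : (fun s : ℝ => f (x + s • (y - x))) = f ∘ (AffineMap.lineMap x y : ℝ →ᵃ[ℝ] E) := by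
      ext s
      simp [AffineMap.lineMap_apply, add_comm]
    rw [he]
    exact this
  have h := hconv.le_slope_of_hasDerivAt (Set.mem_univ 0) (Set.mem_univ 1) one_pos hd
  simp [slope_def_field, -inner_gradient_left] at h
  linarith

/-- Monotonicity of the gradient of a convex function. -/
theorem ConvexOn.inner_gradient_sub_nonneg {f : E → ℝ} (hc : ConvexOn ℝ Set.univ f)
    (hf : Differentiable ℝ f) (x y : E) : 0 ≤ inner ℝ (∇ f x - ∇ f y) (x - y) := by
  have h1 := hc.add_inner_gradient_le hf x y
  have h2 := hc.add_inner_gradient_le hf y x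
  simp only [inner_sub_left, inner_sub_right] at *
  linarith

/-- Both gradient inequalities between `x` and `y` become equalities, so `x` minimizes the tilted
function `f - ⟨∇f(y), ·⟩` and the gradient of that function vanishes at `x`. -/
theorem ConvexOn.gradient_eq_of_inner_eq_zero {f : E → ℝ} (hc : ConvexOn ℝ Set.univ f)
    (hf : Differentiable ℝ f) {x y : E} (h : inner ℝ (∇ f x - ∇ f y) (x - y) = 0) :
    ∇ f x = ∇ f y := by
  have h1 := hc.add_inner_gradient_le hf x y
  have h2 := hc.add_inner_gradient_le hf y x
  have hmin : ∀ w, f x - inner ℝ (∇ f y) x ≤ f w - inner ℝ (∇ f y) w := by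
    intro w
    have h3 := hc.add_inner_gradient_le hf y w
    simp only [inner_sub_left, inner_sub_right] at *
    linarith
  have hloc : IsLocalMin (fun w => f w - inner ℝ (∇ f y) w) x := Eventually.of_forall hmin
  have hd : HasFDerivAt (fun w => f w - inner ℝ (∇ f y) w)
      (fderiv ℝ f x - innerSL ℝ (∇ f y)) x :=
    (hf x).hasFDerivAt.sub (innerSL ℝ (∇ f y)).hasFDerivAt
  have h0 := hloc.hasFDerivAt_eq_zero hd
  refine ext_inner_right ℝ fun v => ?_
  have := congrArg (fun L => L v) h0
  simp at this
  rw [inner_gradient_left, inner_gradient_left]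
  linarith

/-- The descent lemma. -/
theorem le_add_inner_gradient_add_of_lipschitz {f : E → ℝ} (hf : Differentiable ℝ f) {L : ℝ}
    (hL : ∀ x y, ‖∇ f x - ∇ f y‖ ≤ L * ‖x - y‖) (x y : E) :
    f y ≤ f x + inner ℝ (∇ f x) (y - x) + L / 2 * ‖y - x‖ ^ 2 := by
  set d := y - x with hd
  have hder : ∀ t : ℝ, HasDerivAt (fun s : ℝ => f (x + s • d) - s * inner ℝ (∇ f x) d
      - L / 2 * ‖d‖ ^ 2 * s ^ 2)
      (inner ℝ (∇ f (x + t • d)) d - inner ℝ (∇ f x) d - L / 2 * ‖d‖ ^ 2 * (2 * t)) t := by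
    intro t
    have h1 := hasDerivAt_comp_lineMap_gradient hf x d t
    have h2 : HasDerivAt (fun s : ℝ => s * inner ℝ (∇ f x) d) (inner ℝ (∇ f x) d) t := by
      simpa using (hasDerivAt_id t).mul_const (inner ℝ (∇ f x) d)
    have h3 : HasDerivAt (fun s : ℝ => L / 2 * ‖d‖ ^ 2 * s ^ 2) (L / 2 * ‖d‖ ^ 2 * (2 * t)) t := by
      simpa using (hasDerivAt_pow 2 t).const_mul (L / 2 * ‖d‖ ^ 2)
    exact (h1.sub h2).sub h3
  -- Along the segment, `f` minus its quadratic upper model has derivative `⟨∇f(x + td) - ∇f(x), d⟩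
  -- - L t ‖d‖² ≤ 0`; comparing the endpoints gives the claim.
  have hanti : AntitoneOn (fun s : ℝ => f (x + s • d) - s * inner ℝ (∇ f x) d
      - L / 2 * ‖d‖ ^ 2 * s ^ 2) (Set.Icc 0 1) := by
    refine antitoneOn_of_deriv_nonpos (convex_Icc 0 1)
      (fun t _ => (hder t).continuousAt.continuousWithinAt)
      (fun t _ => (hder t).differentiableAt.differentiableWithinAt) fun t ht => ?_
    rw [interior_Icc] at ht
    rw [(hder t).deriv]
    have h1 : inner ℝ (∇ f (x + t • d) - ∇ f x) d ≤ L * (t * ‖d‖) * ‖d‖ := by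
      refine (real_inner_le_norm _ _).trans ?_
      gcongr
      have := hL (x + t • d) x
      simpa [norm_smul, abs_of_pos ht.1] using this
    rw [inner_sub_left] at h1
    nlinarith
  have h := hanti (Set.left_mem_Icc.2 zero_le_one) (Set.right_mem_Icc.2 zero_le_one) zero_le_one
  simp [hd, -inner_gradient_left] at h
  linarith

end Smooth

/-! ### Existence, uniqueness and variational inequality of proximal points. -/

section Prox

variable {n : ℕ} {h : EuclideanSpace ℝ (Fin n) → EReal}

namespace ProperLscConvex

theorem coe_toReal (hh : ProperLscConvex h) {x : EuclideanSpace ℝ (Fin n)} (hx : h x < ⊤) :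
    ((h x).toReal : EReal) = h x :=
  EReal.coe_toReal hx.ne (hh.ne_bot x)

theorem convex_toReal (hh : ProperLscConvex h) {x y : EuclideanSpace ℝ (Fin n)} (hx : h x < ⊤)
    (hy : h y < ⊤) {a b : ℝ} (ha : 0 < a) (hb : 0 < b) (hab : a + b = 1) :
    h (a • x + b • y) < ⊤ ∧
      (h (a • x + b • y)).toReal ≤ a * (h x).toReal + b * (h y).toReal := by
  have h1 := hh.convex x y a b ha hb hab
  rw [← hh.coe_toReal hx, ← hh.coe_toReal hy, ← EReal.coe_mul, ← EReal.coe_mul,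
    ← EReal.coe_add] at h1
  have h2 : h (a • x + b • y) < ⊤ := h1.trans_lt (EReal.coe_lt_top _)
  refine ⟨h2, ?_⟩
  rwa [← hh.coe_toReal h2, EReal.coe_le_coe_iff] at h1

/-- A proper lower semicontinuous convex function has an at most linear decay. -/
theorem exists_linear_lower_bound (hh : ProperLscConvex h) :
    ∃ C : ℝ, 0 ≤ C ∧ ∀ x, ((-(C * (1 + ‖x‖)) : ℝ) : EReal) ≤ h x := by
  obtain ⟨x₀, hx₀⟩ := hh.dom_nonempty
  obtain ⟨u, -, hu⟩ := LowerSemicontinuousOn.exists_isMinOn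
    (s := Metric.closedBall x₀ 1) ⟨x₀, by simp⟩ (isCompact_closedBall x₀ 1)
    (hh.lsc.lowerSemicontinuousOn _)
  obtain ⟨m, -, hm⟩ := EReal.lt_iff_exists_real_btwn.1 (bot_lt_iff_ne_bot.2 (hh.ne_bot u))
  have hball : ∀ x, ‖x - x₀‖ ≤ 1 → (m : EReal) ≤ h x := fun x hx =>
    hm.le.trans (hu (by simpa [dist_eq_norm] using hx))
  set r := (h x₀).toReal with hr
  have hC : 0 ≤ |m| + |r| := by positivity
  refine ⟨2 * (|m| + |r|) * (1 + ‖x₀‖), by positivity, fun x => ?_⟩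
  have hn0 := norm_nonneg x
  have hn1 := norm_nonneg x₀
  have hbig : ‖x - x₀‖ + 1 ≤ 2 * (1 + ‖x₀‖) * (1 + ‖x‖) := by
    have := norm_sub_le x x₀
    nlinarith
  have key : (|m| + |r|) * (‖x - x₀‖ + 1) ≤ 2 * (|m| + |r|) * (1 + ‖x₀‖) * (1 + ‖x‖) := by
    have := mul_le_mul_of_nonneg_left hbig hC
    linarith
  have hmabs := neg_abs_le m
  have hrabs := le_abs_self r
  have hrabs' := neg_abs_le r
  rcases le_or_gt ‖x - x₀‖ 1 with ht | ht
  · refine le_trans ?_ (hball x ht)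
    rw [EReal.coe_le_coe_iff]
    nlinarith [norm_nonneg (x - x₀), abs_nonneg m, abs_nonneg r]
  · rcases eq_or_ne (h x) ⊤ with hx | hx
    · simp [hx]
    have hx' : h x < ⊤ := lt_top_iff_ne_top.2 hx
    set t := ‖x - x₀‖ with htdef
    have ht0 : 0 < t := by linarith
    -- The point of the segment from `x₀` to `x` at distance 1 from `x₀` lies in the ball where `h ≥
    -- m`. Convexity extrapolates this bound to `x`, with a loss linear in `t`.
    have ha : 0 < 1 / t := by positivity
    have hb : 0 < 1 - 1 / t := by
      rw [sub_pos, div_lt_one ht0]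
      exact ht
    obtain ⟨hy, hc⟩ := hh.convex_toReal hx' hx₀ ha hb (by ring)
    have hyn : ‖(1 / t) • x + (1 - 1 / t) • x₀ - x₀‖ ≤ 1 := by
      have : (1 / t) • x + (1 - 1 / t) • x₀ - x₀ = (1 / t) • (x - x₀) := by module
      rw [this, norm_smul, Real.norm_of_nonneg ha.le, ← htdef]
      field_simp
      exact le_rfl
    have hm2 := hball _ hyn
    rw [← hh.coe_toReal hy, EReal.coe_le_coe_iff] at hm2
    rw [← hh.coe_toReal hx', EReal.coe_le_coe_iff]
    have h3 := mul_le_mul_of_nonneg_left (hm2.trans hc) ht0.le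
    have h4 : t * (1 / t * (h x).toReal + (1 - 1 / t) * r) = (h x).toReal + (t - 1) * r := by
      field_simp
    rw [← hr, h4] at h3
    nlinarith [abs_nonneg m, abs_nonneg r]

theorem lsc_add_coe (hh : ProperLscConvex h) {q : EuclideanSpace ℝ (Fin n) → ℝ}
    (hq : Continuous q) : LowerSemicontinuous fun w => h w + ((q w : ℝ) : EReal) := by
  refine hh.lsc.add' (continuous_coe_real_ereal.comp hq).lowerSemicontinuous fun x => ?_
  exact EReal.continuousAt_add (Or.inr (EReal.coe_ne_bot _)) (Or.inl (hh.ne_bot x))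

theorem exists_isProx (hh : ProperLscConvex h) {α : ℝ} (hα : 0 < α)
    (y : EuclideanSpace ℝ (Fin n)) : ∃ p, IsProx α h y p := by
  obtain ⟨x₀, hx₀⟩ := hh.dom_nonempty
  obtain ⟨C, hC0, hC⟩ := hh.exists_linear_lower_bound
  set Q : EuclideanSpace ℝ (Fin n) → EReal :=
    fun w => h w + ((‖w - y‖ ^ 2 / (2 * α) : ℝ) : EReal) with hQ
  have hlsc : LowerSemicontinuous Q := hh.lsc_add_coe (by fun_prop)
  set M : ℝ := (h x₀).toReal + ‖x₀ - y‖ ^ 2 / (2 * α) with hM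
  have hQx₀ : Q x₀ = (M : EReal) := by
    rw [hQ, hM, EReal.coe_add, hh.coe_toReal hx₀]
  set K := C * (1 + ‖y‖) + |M| with hK
  have hK0 : 0 ≤ K := by positivity
  -- For `s = ‖w - y‖ > R` one has `s² / (2α) ≥ s (C + K)`. This pays for the linear decay `C s` of
  -- `h` and, as `s ≥ 1`, for the constant `K`, so the objective exceeds its value `M` at `x₀`. The
  -- last summand of `R` keeps `x₀` in the ball.
  set R := 2 * α * C + 2 * α * K + 1 + ‖x₀ - y‖ with hR
  obtain ⟨p, -, hp⟩ := LowerSemicontinuousOn.exists_isMinOn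
    (s := Metric.closedBall y R) ⟨x₀, by
      rw [Metric.mem_closedBall, dist_eq_norm, hR]
      have : 0 ≤ 2 * α * C + 2 * α * K + 1 := by positivity
      linarith⟩ (isCompact_closedBall y R) (hlsc.lowerSemicontinuousOn _)
  have hpx : Q p ≤ Q x₀ := hp (by
      change dist x₀ y ≤ R
      rw [dist_eq_norm, hR]
      have : 0 ≤ 2 * α * C + 2 * α * K + 1 := by positivity
      linarith)
  have hmin : ∀ w, Q p ≤ Q w := by
    intro w
    rcases le_or_gt ‖w - y‖ R with hw | hw
    · exact hp (by simpa [dist_eq_norm] using hw)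
    · refine hpx.trans ?_
      rw [hQx₀]
      have h1 : ((-(C * (1 + ‖w‖)) + ‖w - y‖ ^ 2 / (2 * α) : ℝ) : EReal) ≤ Q w := by
        rw [EReal.coe_add]
        exact add_le_add (hC w) le_rfl
      refine le_trans ?_ h1
      rw [EReal.coe_le_coe_iff]
      set s := ‖w - y‖ with hs
      have hwn : ‖w‖ ≤ s + ‖y‖ := by
        have := norm_add_le (w - y) y
        simpa using this
      have hs1 : 2 * α * (C + K) + 1 ≤ s := by
        have := norm_nonneg (x₀ - y)
        nlinarith
      have hs0 : 1 ≤ s := by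
        have : 0 ≤ 2 * α * (C + K) := by positivity
        linarith
      have h2 : s * (C + K) ≤ s ^ 2 / (2 * α) := by
        rw [le_div_iff₀ (by positivity)]
        nlinarith
      have h3 := le_abs_self M
      have h4 : K ≤ s * K := le_mul_of_one_le_left hK0 hs0
      nlinarith
  refine ⟨p, Set.mem_univ _, ?_, fun w _ => hmin w⟩
  exact lt_of_le_of_lt hpx (by rw [hQx₀]; exact EReal.coe_lt_top _)

end ProperLscConvex

theorem IsProx.lt_top {α : ℝ} {y p : EuclideanSpace ℝ (Fin n)}
    (hp : IsProx α h y p) : h p < ⊤ := by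
  by_contra hcon
  have h1 : h p = ⊤ := not_lt_top_iff.1 hcon
  have h2 := hp.2.1
  simp only [h1] at h2
  rw [EReal.top_add_coe] at h2
  exact lt_irrefl _ h2

theorem IsProx.le (hh : ProperLscConvex h) {α : ℝ} {y p : EuclideanSpace ℝ (Fin n)}
    (hp : IsProx α h y p) {w : EuclideanSpace ℝ (Fin n)} (hw : h w < ⊤) :
    (h p).toReal + ‖p - y‖ ^ 2 / (2 * α) ≤ (h w).toReal + ‖w - y‖ ^ 2 / (2 * α) := by
  have h1 : h p + ((‖p - y‖ ^ 2 / (2 * α) : ℝ) : EReal)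
      ≤ h w + ((‖w - y‖ ^ 2 / (2 * α) : ℝ) : EReal) := hp.2.2 (Set.mem_univ w)
  rwa [← hh.coe_toReal hw, ← hh.coe_toReal (hp.lt_top), ← EReal.coe_add, ← EReal.coe_add,
    EReal.coe_le_coe_iff] at h1

/-- The variational inequality characterizing the proximal point. -/
theorem IsProx.add_inner_le (hh : ProperLscConvex h) {α : ℝ} (hα : 0 < α)
    {y p : EuclideanSpace ℝ (Fin n)}
    (hp : IsProx α h y p) {w : EuclideanSpace ℝ (Fin n)} (hw : h w < ⊤) :
    inner ℝ (y - p) (w - p) ≤ α * ((h w).toReal - (h p).toReal) := by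
  have hp' := hp.lt_top
  -- Minimality is tested at `t w + (1 - t) p`; after division by `t` the error is linear in `t` and
  -- vanishes as `t → 0`.
  have key : ∀ t : ℝ, 0 < t → t < 1 →
      inner ℝ (y - p) (w - p) ≤ α * ((h w).toReal - (h p).toReal) + t * (‖w - p‖ ^ 2 / 2) := by
    intro t ht0 ht1
    obtain ⟨hz, hc⟩ := hh.convex_toReal hw hp' ht0 (sub_pos.2 ht1) (by ring)
    have h1 := hp.le hh hz
    have h2 : t • w + (1 - t) • p - y = t • (w - p) - (y - p) := by module
    have h3 : ‖t • w + (1 - t) • p - y‖ ^ 2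
        = t ^ 2 * ‖w - p‖ ^ 2 - 2 * (t * inner ℝ (y - p) (w - p)) + ‖p - y‖ ^ 2 := by
      rw [h2, norm_sub_sq_real, norm_smul, inner_smul_left, real_inner_comm, norm_sub_rev y p,
        mul_pow]
      simp
    rw [h3] at h1
    have h4 : (t ^ 2 * ‖w - p‖ ^ 2 - 2 * (t * inner ℝ (y - p) (w - p)) + ‖p - y‖ ^ 2) / (2 * α)
        = (t ^ 2 * ‖w - p‖ ^ 2 - 2 * (t * inner ℝ (y - p) (w - p))) / (2 * α)
          + ‖p - y‖ ^ 2 / (2 * α) := by ring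
    have h5 : t * ((h p).toReal - (h w).toReal)
        ≤ (t ^ 2 * ‖w - p‖ ^ 2 - 2 * (t * inner ℝ (y - p) (w - p))) / (2 * α) := by
      linarith
    rw [le_div_iff₀ (by positivity)] at h5
    have h6 : t * inner ℝ (y - p) (w - p)
        ≤ t * (α * ((h w).toReal - (h p).toReal) + t * (‖w - p‖ ^ 2 / 2)) := by linarith
    exact le_of_mul_le_mul_left h6 ht0
  have hlim : Tendsto (fun t : ℝ => α * ((h w).toReal - (h p).toReal) + t * (‖w - p‖ ^ 2 / 2))
      (𝓝[>] 0) (𝓝 (α * ((h w).toReal - (h p).toReal) + 0 * (‖w - p‖ ^ 2 / 2))) := by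
    refine Tendsto.mono_left ?_ nhdsWithin_le_nhds
    exact Continuous.tendsto (by fun_prop) 0
  rw [zero_mul, add_zero] at hlim
  refine ge_of_tendsto hlim ?_
  filter_upwards [Ioo_mem_nhdsGT (zero_lt_one' ℝ)] with t ht
  exact key t ht.1 ht.2

/-- The sum of the variational inequalities of `p` and `q` is `‖p - q‖² ≤ 0`. -/
theorem IsProx.unique (hh : ProperLscConvex h) {α : ℝ} (hα : 0 < α)
    {y p q : EuclideanSpace ℝ (Fin n)} (hp : IsProx α h y p) (hq : IsProx α h y q) : p = q := by
  have h1 := hp.add_inner_le hh hα (hq.lt_top)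
  have h2 := hq.add_inner_le hh hα (hp.lt_top)
  have h3 : inner ℝ (y - p) (q - p) + inner ℝ (y - q) (p - q) = ‖p - q‖ ^ 2 := by
    rw [← real_inner_self_eq_norm_sq, ← neg_sub p q, inner_neg_right]
    simp only [inner_sub_left]
    ring
  have h4 : ‖p - q‖ ^ 2 ≤ 0 := by linarith
  rw [← sub_eq_zero, ← norm_eq_zero]
  exact pow_eq_zero_iff (two_ne_zero) |>.1 (le_antisymm h4 (by positivity))

end Prox

/-! ### Real-valued costs on the common domain, and the penalized nonsmooth part. -/

namespace BilevelProblem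

variable {n : ℕ} (P : BilevelProblem n)

/-- The common domain of the two costs. -/
def dom : Set (EuclideanSpace ℝ (Fin n)) := {x | P.g₁ x < ⊤ ∧ P.g₂ x < ⊤}

/-- The real value of the upper level cost on the domain. -/
def val₁ (x : EuclideanSpace ℝ (Fin n)) : ℝ := P.f₁ x + (P.g₁ x).toReal

/-- The real value of the lower level cost on the domain. -/
def val₂ (x : EuclideanSpace ℝ (Fin n)) : ℝ := P.f₂ x + (P.g₂ x).toReal

variable {P}

theorem f_differentiable (hP : P.BasicAssumption) (σ : ℝ) : Differentiable ℝ (P.f σ) :=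
  ((hP.f₁_contDiff.differentiable one_ne_zero).const_mul σ).add
    (hP.f₂_contDiff.differentiable one_ne_zero)

theorem f_convex (hP : P.BasicAssumption) {σ : ℝ} (hσ : 0 ≤ σ) : ConvexOn ℝ Set.univ (P.f σ) :=
  (hP.f₁_convex.smul hσ).add hP.f₂_convex

theorem gradient_f (hP : P.BasicAssumption) (σ : ℝ) (x : EuclideanSpace ℝ (Fin n)) :
    ∇ (P.f σ) x = σ • ∇ P.f₁ x + ∇ P.f₂ x := by
  have h1 := (hP.f₁_contDiff.differentiable one_ne_zero) x
  have h2 := (hP.f₂_contDiff.differentiable one_ne_zero) x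
  refine ext_inner_right ℝ fun v => ?_
  have h3 : HasFDerivAt (P.f σ) (σ • fderiv ℝ P.f₁ x + fderiv ℝ P.f₂ x) x :=
    (h1.hasFDerivAt.const_mul σ).add h2.hasFDerivAt
  rw [inner_add_left, inner_smul_left, inner_gradient_left, inner_gradient_left,
    inner_gradient_left, h3.fderiv]
  simp

section Values

variable {x y : EuclideanSpace ℝ (Fin n)} {σ : ℝ}

theorem cost₁_eq (hP : P.BasicAssumption) (hx : P.g₁ x < ⊤) : P.cost₁ x = (P.val₁ x : EReal) := by
  rw [cost₁, val₁, EReal.coe_add, hP.g₁_proper.coe_toReal hx]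

theorem cost₂_eq (hP : P.BasicAssumption) (hx : P.g₂ x < ⊤) : P.cost₂ x = (P.val₂ x : EReal) := by
  rw [cost₂, val₂, EReal.coe_add, hP.g₂_proper.coe_toReal hx]

theorem g₁_lt_top_of_cost₁ (hx : P.cost₁ x < ⊤) : P.g₁ x < ⊤ := by
  rw [lt_top_iff_ne_top]
  intro h
  rw [cost₁, h, EReal.coe_add_top] at hx
  exact lt_irrefl _ hx

theorem g₂_lt_top_of_cost₂ (hx : P.cost₂ x < ⊤) : P.g₂ x < ⊤ := by
  rw [lt_top_iff_ne_top]
  intro h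
  rw [cost₂, h, EReal.coe_add_top] at hx
  exact lt_irrefl _ hx

theorem convex_val (hP : P.BasicAssumption)
    (hx : x ∈ P.dom) (hy : y ∈ P.dom) {a b : ℝ} (ha : 0 < a) (hb : 0 < b)
    (hab : a + b = 1) :
    a • x + b • y ∈ P.dom ∧ P.val₁ (a • x + b • y) ≤ a * P.val₁ x + b * P.val₁ y ∧
      P.val₂ (a • x + b • y) ≤ a * P.val₂ x + b * P.val₂ y := by
  obtain ⟨h1, h2⟩ := hP.g₁_proper.convex_toReal hx.1 hy.1 ha hb hab
  obtain ⟨h3, h4⟩ := hP.g₂_proper.convex_toReal hx.2 hy.2 ha hb hab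
  have h5 := hP.f₁_convex.2 (Set.mem_univ x) (Set.mem_univ y) ha.le hb.le hab
  have h6 := hP.f₂_convex.2 (Set.mem_univ x) (Set.mem_univ y) ha.le hb.le hab
  simp only [smul_eq_mul] at h5 h6
  refine ⟨⟨h1, h3⟩, ?_, ?_⟩ <;> simp only [val₁, val₂] <;> linarith

theorem mem_dom_of_mem_X₁ (hx : x ∈ P.X₁) : x ∈ P.dom :=
  ⟨g₁_lt_top_of_cost₁ hx.2.1, g₂_lt_top_of_cost₂ hx.1.2.1⟩

theorem val₂_le_of_mem_X₁ (hP : P.BasicAssumption)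
    (hx : x ∈ P.X₁) (hy : y ∈ P.dom) : P.val₂ x ≤ P.val₂ y := by
  have h1 : P.cost₂ x ≤ P.cost₂ y := hx.1.2.2 (Set.mem_univ y)
  rwa [cost₂_eq hP (mem_dom_of_mem_X₁ hx).2, cost₂_eq hP hy.2, EReal.coe_le_coe_iff] at h1

theorem mem_X₁_of_val_le (hP : P.BasicAssumption)
    (hx : x ∈ P.X₁) (hy : y ∈ P.dom) (h1 : P.val₁ y ≤ P.val₁ x)
    (h2 : P.val₂ y ≤ P.val₂ x) : y ∈ P.X₁ := by
  have hxd := mem_dom_of_mem_X₁ hx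
  have c1 : P.cost₁ y ≤ P.cost₁ x := by
    rw [cost₁_eq hP hxd.1, cost₁_eq hP hy.1, EReal.coe_le_coe_iff]
    exact h1
  have c2 : P.cost₂ y ≤ P.cost₂ x := by
    rw [cost₂_eq hP hxd.2, cost₂_eq hP hy.2, EReal.coe_le_coe_iff]
    exact h2
  exact ⟨⟨Set.mem_univ _, c2.trans_lt hx.1.2.1, fun w hw => c2.trans (hx.1.2.2 hw)⟩,
    c1.trans_lt hx.2.1, fun w hw => c1.trans (hx.2.2 hw)⟩

theorem val₁_eq_of_mem_X₁ (hP : P.BasicAssumption)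
    (hx : x ∈ P.X₁) (hy : y ∈ P.X₁) : P.val₁ x = P.val₁ y := by
  have hxd := mem_dom_of_mem_X₁ hx
  have hyd := mem_dom_of_mem_X₁ hy
  have h1 : P.cost₁ x ≤ P.cost₁ y := hx.2.2 hy.1
  have h2 : P.cost₁ y ≤ P.cost₁ x := hy.2.2 hx.1
  rw [cost₁_eq hP hxd.1, cost₁_eq hP hyd.1, EReal.coe_le_coe_iff] at h1 h2
  exact le_antisymm h1 h2

theorem exists_le_val₁ (hP : P.BasicAssumption) : ∃ m : ℝ, ∀ x ∈ P.dom, m ≤ P.val₁ x := by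
  obtain ⟨m, -, hm⟩ := EReal.lt_iff_exists_real_btwn.1 hP.cost₁_lower
  refine ⟨m, fun x hx => ?_⟩
  have h1 : (m : EReal) ≤ P.cost₁ x := hm.le.trans (iInf₂_le x hx.2)
  rwa [cost₁_eq hP hx.1, EReal.coe_le_coe_iff] at h1

theorem g_toReal (hP : P.BasicAssumption) (hx : x ∈ P.dom) :
    P.g σ x = ((σ * (P.g₁ x).toReal + (P.g₂ x).toReal : ℝ) : EReal) := by
  rw [EReal.coe_add, EReal.coe_mul, hP.g₁_proper.coe_toReal hx.1, hP.g₂_proper.coe_toReal hx.2, g]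

/-- Positivity of `σ` matters: `0 * ⊤ = 0` in `EReal`, so for `σ = 0` only the domain of `g₂` would
count. -/
theorem g_eq_top (hP : P.BasicAssumption) (hσ : 0 < σ) (hx : x ∉ P.dom) : P.g σ x = ⊤ := by
  rw [g]
  rcases eq_or_ne (P.g₁ x) ⊤ with h | h
  · rw [h, EReal.coe_mul_top_of_pos hσ, EReal.top_add_of_ne_bot (hP.g₂_proper.ne_bot x)]
  · have h2 : P.g₂ x = ⊤ := by
      by_contra h2
      exact hx ⟨lt_top_iff_ne_top.2 h, lt_top_iff_ne_top.2 h2⟩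
    rw [h2, ← hP.g₁_proper.coe_toReal (lt_top_iff_ne_top.2 h), ← EReal.coe_mul, EReal.coe_add_top]

theorem g_lt_top_iff (hP : P.BasicAssumption) (hσ : 0 < σ) : P.g σ x < ⊤ ↔ x ∈ P.dom := by
  refine ⟨fun h => ?_, fun h => ?_⟩
  · by_contra hx
    rw [g_eq_top hP hσ hx] at h
    exact lt_irrefl _ h
  · rw [g_toReal hP h]
    exact EReal.coe_lt_top _

theorem g_ne_bot (hP : P.BasicAssumption)
    (hσ : 0 < σ) (x : EuclideanSpace ℝ (Fin n)) : P.g σ x ≠ ⊥ := by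
  by_cases hx : x ∈ P.dom
  · rw [g_toReal hP hx]
    exact EReal.coe_ne_bot _
  · rw [g_eq_top hP hσ hx]
    exact top_ne_bot

theorem g_proper (hP : P.BasicAssumption) (hσ : 0 < σ) : ProperLscConvex (P.g σ) where
  ne_bot := g_ne_bot hP hσ
  dom_nonempty := by
    obtain ⟨x, hx⟩ := hP.X₁_nonempty
    exact ⟨x, (g_lt_top_iff hP hσ).2 (mem_dom_of_mem_X₁ hx)⟩
  lsc := by
    have hcont : Continuous fun t : EReal => (σ : EReal) * t := by
      refine continuous_iff_continuousAt.2 fun t => ?_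
      have : ContinuousAt (fun p : EReal × EReal => p.1 * p.2) ((σ : EReal), t) := by
        apply EReal.continuousAt_mul <;> simp [hσ.ne']
      exact this.comp (f := fun t : EReal => ((σ : EReal), t)) (by fun_prop)
    have hmono : Monotone fun t : EReal => (σ : EReal) * t := fun s t hst =>
      mul_le_mul_of_nonneg_left hst (EReal.coe_nonneg.2 hσ.le)
    have h1 : LowerSemicontinuous fun x => (σ : EReal) * P.g₁ x :=
      hcont.comp_lowerSemicontinuous hP.g₁_proper.lsc hmono
    refine h1.add' hP.g₂_proper.lsc fun x => ?_
    refine EReal.continuousAt_add (Or.inr (hP.g₂_proper.ne_bot x)) (Or.inl ?_)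
    have := (EReal.add_ne_bot_iff.1 (g_ne_bot hP hσ x)).1
    exact this
  convex := by
    intro x y a b ha hb hab
    have hpos : ∀ {c : ℝ}, 0 < c → ∀ w, (c : EReal) * P.g σ w ≠ ⊥ := by
      intro c hc w
      by_cases hw : w ∈ P.dom
      · rw [g_toReal hP hw, ← EReal.coe_mul]
        exact EReal.coe_ne_bot _
      · rw [g_eq_top hP hσ hw, EReal.coe_mul_top_of_pos hc]
        exact top_ne_bot
    by_cases hx : x ∈ P.dom
    · by_cases hy : y ∈ P.dom
      · obtain ⟨h1, h2⟩ := hP.g₁_proper.convex_toReal hx.1 hy.1 ha hb hab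
        obtain ⟨h3, h4⟩ := hP.g₂_proper.convex_toReal hx.2 hy.2 ha hb hab
        rw [g_toReal hP hx, g_toReal hP hy, g_toReal hP ⟨h1, h3⟩, ← EReal.coe_mul,
          ← EReal.coe_mul, ← EReal.coe_add, EReal.coe_le_coe_iff]
        nlinarith
      · rw [g_eq_top hP hσ hy, EReal.coe_mul_top_of_pos hb, EReal.add_top_of_ne_bot (hpos ha x)]
        exact le_top
    · rw [g_eq_top hP hσ hx, EReal.coe_mul_top_of_pos ha, EReal.top_add_of_ne_bot (hpos hb y)]
      exact le_top

end Values

/-! ### Joint level sets of the two costs. -/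

section LevelSets

variable {xs : EuclideanSpace ℝ (Fin n)}

/-- Finite bounds on both costs already force membership in `dom`, so this is an intersection of
sublevel sets of two lower semicontinuous functions. -/
theorem isClosed_levelSet (hP : P.BasicAssumption) (a b : ℝ) :
    IsClosed {x | x ∈ P.dom ∧ P.val₁ x ≤ a ∧ P.val₂ x ≤ b} := by
  have l1 : LowerSemicontinuous P.cost₁ := by
    have h := hP.g₁_proper.lsc_add_coe hP.f₁_contDiff.continuous
    simp only [add_comm] at h
    exact h
  have l2 : LowerSemicontinuous P.cost₂ := by
    have h := hP.g₂_proper.lsc_add_coe hP.f₂_contDiff.continuous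
    simp only [add_comm] at h
    exact h
  have := (l1.isClosed_preimage (a : EReal)).inter (l2.isClosed_preimage (b : EReal))
  convert this using 1
  ext x
  constructor
  · rintro ⟨hx, h1, h2⟩
    refine ⟨?_, ?_⟩
    · change P.cost₁ x ≤ a
      rw [cost₁_eq hP hx.1, EReal.coe_le_coe_iff]
      exact h1
    · change P.cost₂ x ≤ b
      rw [cost₂_eq hP hx.2, EReal.coe_le_coe_iff]
      exact h2
  · rintro ⟨h1, h2⟩
    change P.cost₁ x ≤ a at h1
    change P.cost₂ x ≤ b at h2
    have hx : x ∈ P.dom := ⟨g₁_lt_top_of_cost₁ (h1.trans_lt (EReal.coe_lt_top _)),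
      g₂_lt_top_of_cost₂ (h2.trans_lt (EReal.coe_lt_top _))⟩
    rw [cost₁_eq hP hx.1, EReal.coe_le_coe_iff] at h1
    rw [cost₂_eq hP hx.2, EReal.coe_le_coe_iff] at h2
    exact ⟨hx, h1, h2⟩

/-- On a compact set missing the solutions, small values of both gaps are impossible. -/
theorem exists_pos_forall_notMem_levelSet (hP : P.BasicAssumption)
    (hxs : xs ∈ P.X₁) {K : Set (EuclideanSpace ℝ (Fin n))}
    (hK : IsCompact K) (hKX : ∀ x ∈ K, x ∉ P.X₁) :
    ∃ δ : ℝ, 0 < δ ∧ ∀ x ∈ K, x ∈ P.dom → P.val₁ x ≤ P.val₁ xs + δ →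
      P.val₂ x ≤ P.val₂ xs + δ → False := by
  -- Otherwise points of `K` with both gaps at most `1 / (N + 1)` accumulate at a point of `K` with
  -- nonpositive gaps, which is a solution.
  by_contra! hcon
  have hcon' : ∀ N : ℕ, ∃ x ∈ K, x ∈ P.dom ∧ P.val₁ x ≤ P.val₁ xs + 1 / ((N : ℝ) + 1) ∧
      P.val₂ x ≤ P.val₂ xs + 1 / ((N : ℝ) + 1) := by
    intro N
    obtain ⟨x, h1, h2, h3, h4, -⟩ := hcon (1 / ((N : ℝ) + 1)) (by positivity)
    exact ⟨x, h1, h2, h3, h4⟩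
  choose u huK hud hu1 hu2 using hcon'
  obtain ⟨z, hzK, s, hs, hz⟩ := hK.tendsto_subseq huK
  have hlim : Tendsto (fun N : ℕ => 1 / ((N : ℝ) + 1)) atTop (𝓝 0) :=
    tendsto_one_div_add_atTop_nhds_zero_nat
  have hlev : ∀ ε : ℝ, 0 < ε → z ∈ P.dom ∧ P.val₁ z ≤ P.val₁ xs + ε ∧ P.val₂ z ≤ P.val₂ xs + ε := by
    intro ε hε
    refine (isClosed_levelSet hP (P.val₁ xs + ε) (P.val₂ xs + ε)).mem_of_tendsto hz ?_
    have := (hlim.comp hs.tendsto_atTop).eventually (gt_mem_nhds hε)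
    filter_upwards [this] with N hN
    have hN' : 1 / (((s N : ℕ) : ℝ) + 1) < ε := hN
    exact ⟨hud _, by have := hu1 (s N); simp only [Function.comp]; linarith,
      by have := hu2 (s N); simp only [Function.comp]; linarith⟩
  refine hKX z hzK (mem_X₁_of_val_le hP hxs (hlev 1 one_pos).1 ?_ ?_)
  · exact le_of_forall_pos_le_add fun ε hε => (hlev ε hε).2.1
  · exact le_of_forall_pos_le_add fun ε hε => (hlev ε hε).2.2

/-- A far point of the level set is pulled towards `xs` onto a sphere enclosing `X₁` and disjoint
from it. By convexity the pull multiplies the bound `M` on both gaps by `t = (r + 1) / ‖x - xs‖`. If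
`x` is too far, the result is below the threshold `δ` that is impossible on the sphere. -/
theorem exists_levelSet_bound (hP : P.BasicAssumption) (hxs : xs ∈ P.X₁) (M : ℝ) :
    ∃ R : ℝ, ∀ x ∈ P.dom, P.val₁ x ≤ P.val₁ xs + M → P.val₂ x ≤ P.val₂ xs + M →
      ‖x - xs‖ ≤ R := by
  obtain ⟨r, hr⟩ := hP.X₁_compact.isBounded.subset_closedBall xs
  have hr0 : 0 ≤ r := by
    have := hr hxs
    simpa using this
  have hmiss : ∀ x ∈ Metric.sphere xs (r + 1), x ∉ P.X₁ := by
    intro x hx hxX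
    have h1 := hr hxX
    rw [Metric.mem_closedBall] at h1
    rw [Metric.mem_sphere] at hx
    linarith
  obtain ⟨δ, hδ, hδ'⟩ :=
    exists_pos_forall_notMem_levelSet hP hxs (isCompact_sphere xs (r + 1)) hmiss
  refine ⟨(r + 1) * (1 + |M| / δ), fun x hx h1 h2 => ?_⟩
  by_contra! hcon
  have hM := div_nonneg (abs_nonneg M) hδ.le
  set s := ‖x - xs‖ with hs
  have hs1 : r + 1 < s := by nlinarith
  have hs0 : 0 < s := by linarith
  set t := (r + 1) / s with ht
  have ht0 : 0 < t := by positivity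
  have ht1 : t < 1 := by rw [ht, div_lt_one hs0]; exact hs1
  obtain ⟨hd, c1, c2⟩ := convex_val hP hx (mem_dom_of_mem_X₁ hxs) ht0 (sub_pos.2 ht1) (by ring)
  have htM : t * M ≤ δ := by
    have h3 : (r + 1) * |M| ≤ δ * s := by
      have h4 : (r + 1) * (1 + |M| / δ) * δ ≤ s * δ := mul_le_mul_of_nonneg_right hcon.le hδ.le
      have h5 : (r + 1) * (1 + |M| / δ) * δ = (r + 1) * δ + (r + 1) * |M| := by
        field_simp
      nlinarith
    have h6 : t * |M| ≤ δ := by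
      rw [ht, div_mul_eq_mul_div, div_le_iff₀ hs0]
      exact h3
    exact (mul_le_mul_of_nonneg_left (le_abs_self M) ht0.le).trans h6
  refine hδ' _ ?_ hd ?_ ?_
  · rw [Metric.mem_sphere, dist_eq_norm]
    have : t • x + (1 - t) • xs - xs = t • (x - xs) := by module
    rw [this, norm_smul, Real.norm_of_nonneg ht0.le, ← hs, ht]
    field_simp
  · nlinarith [mul_le_mul_of_nonneg_left h1 ht0.le]
  · nlinarith [mul_le_mul_of_nonneg_left h2 ht0.le]

/-- The level set with margin 1 lies in a ball; removing the open `ε`-neighbourhood of `X₁` from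
that ball leaves a compact set that misses `X₁`. -/
theorem exists_levelSet_near (hP : P.BasicAssumption) (hxs : xs ∈ P.X₁) {ε : ℝ} (hε : 0 < ε) :
    ∃ δ : ℝ, 0 < δ ∧ ∀ x ∈ P.dom, P.val₁ x ≤ P.val₁ xs + δ → P.val₂ x ≤ P.val₂ xs + δ →
      ∃ y ∈ P.X₁, ‖x - y‖ < ε := by
  obtain ⟨R, hR⟩ := exists_levelSet_bound hP hxs 1
  have hK : IsCompact (Metric.closedBall xs R \ Metric.thickening ε P.X₁) :=
    (isCompact_closedBall xs R).diff Metric.isOpen_thickening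
  obtain ⟨δ, hδ, hδ'⟩ := exists_pos_forall_notMem_levelSet hP hxs hK
    (fun x hx hxX => hx.2 (Metric.self_subset_thickening hε _ hxX))
  refine ⟨min δ 1, by positivity, fun x hx h1 h2 => ?_⟩
  by_contra hcon
  have hm1 := min_le_left δ 1
  have hm2 := min_le_right δ 1
  refine hδ' x ⟨?_, ?_⟩ hx (by linarith) (by linarith)
  · rw [Metric.mem_closedBall, dist_eq_norm]
    exact hR x hx (by linarith) (by linarith)
  · intro hth
    obtain ⟨y, hy, hxy⟩ := Metric.mem_thickening_iff.1 hth
    exact hcon ⟨y, hy, by rwa [← dist_eq_norm]⟩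

end LevelSets

/-! ### Proximal gradient steps: bounds uniform in stepsize and penalty. -/

section Steps

theorem le_of_sq_le_add_mul {p q t : ℝ} (hp : 0 ≤ p) (hq : 0 ≤ q) (h : t ^ 2 ≤ p + q * t) :
    t ≤ p + q + 1 := by
  by_contra! hcon
  have h1 : 1 ≤ t := by linarith
  have h2 : (p + q + 1) * t < t * t := mul_lt_mul_of_pos_right hcon (by linarith)
  have h3 : p * 1 ≤ p * t := mul_le_mul_of_nonneg_left h1 hp
  nlinarith

theorem IsProxGradStep.mem_dom (hP : P.BasicAssumption)
    {σ α : ℝ} (hσ : 0 < σ) {x z : EuclideanSpace ℝ (Fin n)}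
    (h : P.IsProxGradStep σ α x z) : z ∈ P.dom :=
  (g_lt_top_iff hP hσ).1 (IsProx.lt_top h)

theorem IsProxGradStep.inner_le (hP : P.BasicAssumption) {σ α : ℝ} (hσ : 0 < σ) (hα : 0 < α)
    {x z w : EuclideanSpace ℝ (Fin n)} (h : P.IsProxGradStep σ α x z) (hw : w ∈ P.dom) :
    inner ℝ (x - α • ∇ (P.f σ) x - z) (w - z) ≤
      α * (σ * ((P.g₁ w).toReal - (P.g₁ z).toReal) + ((P.g₂ w).toReal - (P.g₂ z).toReal)) := by
  have h1 := IsProx.add_inner_le (g_proper hP hσ) hα h ((g_lt_top_iff hP hσ).2 hw)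
  rw [g_toReal hP hw, g_toReal hP (h.mem_dom hP hσ), EReal.toReal_coe, EReal.toReal_coe] at h1
  refine h1.trans (le_of_eq ?_)
  ring

theorem IsProxGradStep.unique (hP : P.BasicAssumption) {σ α : ℝ} (hσ : 0 < σ) (hα : 0 < α)
    {x z w : EuclideanSpace ℝ (Fin n)} (h : P.IsProxGradStep σ α x z)
    (h' : P.IsProxGradStep σ α x w) : z = w :=
  IsProx.unique (g_proper hP hσ) hα h h'

theorem exists_isProxGradStep (hP : P.BasicAssumption) {σ α : ℝ} (hσ : 0 < σ) (hα : 0 < α)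
    (x : EuclideanSpace ℝ (Fin n)) : ∃ z, P.IsProxGradStep σ α x z :=
  (g_proper hP hσ).exists_isProx hα _

/-- Proximal gradient steps from bounded points with bounded stepsizes and penalties are bounded. -/
theorem exists_isProxGradStep_bound (hP : P.BasicAssumption)
    (s A K : ℝ) (hs : 0 ≤ s) (hA : 0 ≤ A) (hK : 0 ≤ K) :
    ∃ R : ℝ, ∀ σ a x z, 0 < σ → σ ≤ s → 0 < a → a ≤ A → ‖x‖ ≤ K →
      P.IsProxGradStep σ a x z → ‖z‖ ≤ R := by
  obtain ⟨xs, hxs⟩ := hP.X₁_nonempty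
  have hxd := mem_dom_of_mem_X₁ hxs
  obtain ⟨C₁, hC₁, hb₁⟩ := hP.g₁_proper.exists_linear_lower_bound
  obtain ⟨C₂, hC₂, hb₂⟩ := hP.g₂_proper.exists_linear_lower_bound
  obtain ⟨N₁, hN₁⟩ := (isCompact_closedBall (0 : EuclideanSpace ℝ (Fin n)) K)
    |>.exists_bound_of_continuousOn
    hP.f₁_locallyLipschitz.continuous.continuousOn
  obtain ⟨N₂, hN₂⟩ := (isCompact_closedBall (0 : EuclideanSpace ℝ (Fin n)) K)
    |>.exists_bound_of_continuousOn
    hP.f₂_locallyLipschitz.continuous.continuousOn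
  have hN₁0 : 0 ≤ N₁ := (norm_nonneg _).trans (hN₁ 0 (by simpa using hK))
  have hN₂0 : 0 ≤ N₂ := (norm_nonneg _).trans (hN₂ 0 (by simpa using hK))
  -- `Y` bounds the forward point `y`, `C` the linear decay of `g_σ`, and `c` the value of `g_σ` at
  -- `xs`. Comparing the proximal objective at `z` and at `xs` gives `t² ≤ p + q t` for `t = ‖z -
  -- y‖`.
  set Y := K + A * (s * N₁ + N₂) with hY
  have hY0 : 0 ≤ Y := by positivity
  set C := s * C₁ + C₂ with hC
  have hC0 : 0 ≤ C := by positivity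
  set c := s * |(P.g₁ xs).toReal| + |(P.g₂ xs).toReal| with hc
  have hc0 : 0 ≤ c := by positivity
  set p := (‖xs‖ + Y) ^ 2 + 2 * A * (c + C * (1 + Y)) with hp
  set q := 2 * A * C with hq
  have hp0 : 0 ≤ p := by positivity
  have hq0 : 0 ≤ q := by positivity
  refine ⟨Y + (p + q + 1), fun σ a x z hσ hσs ha haA hx hz => ?_⟩
  have hzd := hz.mem_dom hP hσ
  set y := x - a • ∇ (P.f σ) x with hy
  have hyY : ‖y‖ ≤ Y := by
    have h1 : ‖∇ (P.f σ) x‖ ≤ s * N₁ + N₂ := by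
      rw [gradient_f hP]
      refine (norm_add_le _ _).trans ?_
      rw [norm_smul, Real.norm_of_nonneg hσ.le]
      have := hN₁ x (by simpa using hx)
      have := hN₂ x (by simpa using hx)
      gcongr
    refine (norm_sub_le _ _).trans ?_
    rw [norm_smul, Real.norm_of_nonneg ha.le, hY]
    gcongr
  have hle := IsProx.le (g_proper hP hσ) hz ((g_lt_top_iff hP hσ).2 hxd)
  rw [g_toReal hP hxd, g_toReal hP hzd, EReal.toReal_coe, EReal.toReal_coe, ← hy] at hle
  have hg₁ : -(C₁ * (1 + ‖z‖)) ≤ (P.g₁ z).toReal := by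
    have := hb₁ z
    rwa [← hP.g₁_proper.coe_toReal hzd.1, EReal.coe_le_coe_iff] at this
  have hg₂ : -(C₂ * (1 + ‖z‖)) ≤ (P.g₂ z).toReal := by
    have := hb₂ z
    rwa [← hP.g₂_proper.coe_toReal hzd.2, EReal.coe_le_coe_iff] at this
  set t := ‖z - y‖ with ht
  have ht0 : 0 ≤ t := norm_nonneg _
  have hzt : ‖z‖ ≤ t + Y := by
    have h1 := norm_add_le (z - y) y
    rw [sub_add_cancel] at h1
    linarith
  have h1 : t ^ 2 ≤ ‖xs - y‖ ^ 2 + 2 * a * (σ * (P.g₁ xs).toReal + (P.g₂ xs).toReal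
      - (σ * (P.g₁ z).toReal + (P.g₂ z).toReal)) := by
    have h2 := mul_le_mul_of_nonneg_left hle (by positivity : 0 ≤ 2 * a)
    have h3 : 2 * a * (σ * (P.g₁ z).toReal + (P.g₂ z).toReal + t ^ 2 / (2 * a))
      = 2 * a * (σ * (P.g₁ z).toReal + (P.g₂ z).toReal) + t ^ 2 := by field_simp
    have h4 : 2 * a * (σ * (P.g₁ xs).toReal + (P.g₂ xs).toReal + ‖xs - y‖ ^ 2 / (2 * a))
      = 2 * a * (σ * (P.g₁ xs).toReal + (P.g₂ xs).toReal) + ‖xs - y‖ ^ 2 := by field_simp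
    rw [h3, h4] at h2
    linarith
  have h2 : ‖xs - y‖ ^ 2 ≤ (‖xs‖ + Y) ^ 2 := by
    have := norm_sub_le xs y
    gcongr
    linarith
  have h3 : σ * (P.g₁ xs).toReal + (P.g₂ xs).toReal ≤ c := by
    have := le_abs_self (P.g₁ xs).toReal
    have := le_abs_self (P.g₂ xs).toReal
    have e1 : σ * (P.g₁ xs).toReal ≤ σ * |(P.g₁ xs).toReal| := by gcongr
    have e2 : σ * |(P.g₁ xs).toReal| ≤ s * |(P.g₁ xs).toReal| := by gcongr
    linarith
  have h4 : -(σ * (P.g₁ z).toReal + (P.g₂ z).toReal) ≤ C * (1 + Y + t) := by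
    have e1 : -(σ * (P.g₁ z).toReal) ≤ σ * (C₁ * (1 + ‖z‖)) := by nlinarith
    have e0 : 1 + ‖z‖ ≤ 1 + Y + t := by linarith
    have e2 : σ * (C₁ * (1 + ‖z‖)) ≤ s * (C₁ * (1 + Y + t)) :=
      mul_le_mul hσs (mul_le_mul_of_nonneg_left e0 hC₁) (by positivity) hs
    have e3 : C₂ * (1 + ‖z‖) ≤ C₂ * (1 + Y + t) := mul_le_mul_of_nonneg_left e0 hC₂
    rw [hC]
    linarith
  have h5 : 2 * a * (σ * (P.g₁ xs).toReal + (P.g₂ xs).toReal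
      - (σ * (P.g₁ z).toReal + (P.g₂ z).toReal)) ≤ 2 * A * (c + C * (1 + Y + t)) := by
    have e1 : 2 * a * (σ * (P.g₁ xs).toReal + (P.g₂ xs).toReal
      - (σ * (P.g₁ z).toReal + (P.g₂ z).toReal)) ≤ 2 * a * (c + C * (1 + Y + t)) := by
      gcongr
      linarith
    refine e1.trans ?_
    gcongr
  have h6 : t ^ 2 ≤ p + q * t := by
    rw [hp, hq]
    linarith
  have h7 : t ≤ p + q + 1 := le_of_sq_le_add_mul hp0 hq0 h6
  linarith

/-- The gradients are Lipschitz on balls, uniformly for bounded penalties. -/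
theorem exists_lipschitz_on_ball (hP : P.BasicAssumption) (s R : ℝ) (hs : 0 ≤ s) :
    ∃ L : ℝ, 0 < L ∧ ∀ σ u v, 0 < σ → σ ≤ s → ‖u‖ ≤ R → ‖v‖ ≤ R →
      ‖∇ (P.f σ) u - ∇ (P.f σ) v‖ ≤ L * ‖u - v‖ := by
  obtain ⟨L₁, hL₁⟩ := LocallyLipschitzOn.exists_lipschitzOnWith_of_compact
    (isCompact_closedBall (0 : EuclideanSpace ℝ (Fin n)) R)
    (hP.f₁_locallyLipschitz.locallyLipschitzOn)
  obtain ⟨L₂, hL₂⟩ := LocallyLipschitzOn.exists_lipschitzOnWith_of_compact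
    (isCompact_closedBall (0 : EuclideanSpace ℝ (Fin n)) R)
    (hP.f₂_locallyLipschitz.locallyLipschitzOn)
  refine ⟨s * L₁ + L₂ + 1, by positivity, fun σ u v hσ hσs hu hv => ?_⟩
  have h1 := hL₁.norm_sub_le (by simpa using hu) (by simpa using hv)
  have h2 := hL₂.norm_sub_le (by simpa using hu) (by simpa using hv)
  rw [gradient_f hP, gradient_f hP]
  have h3 : σ • ∇ P.f₁ u + ∇ P.f₂ u - (σ • ∇ P.f₁ v + ∇ P.f₂ v)
      = σ • (∇ P.f₁ u - ∇ P.f₁ v) + (∇ P.f₂ u - ∇ P.f₂ v) := by module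
  rw [h3]
  refine (norm_add_le _ _).trans ?_
  rw [norm_smul, Real.norm_of_nonneg hσ.le]
  have h4 : σ * ‖∇ P.f₁ u - ∇ P.f₁ v‖ ≤ s * (L₁ * ‖u - v‖) := by gcongr
  nlinarith [norm_nonneg (u - v)]

end Steps

end BilevelProblem

/-! ### Abstract convergence argument for decreasing energies. -/

/-- Source of the contradictions below: a nonnegative energy cannot absorb losses whose sum
diverges. -/
theorem exists_neg_of_le_sub {Z : ℕ → ℝ} {K : ℕ} {d : ℕ → ℝ}
    (hZ : ∀ k, K ≤ k → Z (k + 1) ≤ Z k - d k)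
    (hd : Tendsto (fun m => ∑ k ∈ Finset.range m, d k) atTop atTop) : ∃ k, Z k < 0 := by
  have h1 : ∀ m, K ≤ m → Z m ≤ Z K - (∑ k ∈ Finset.range m, d k - ∑ k ∈ Finset.range K, d k) := by
    intro m hm
    induction m, hm using Nat.le_induction with
    | base => simp
    | succ m hm ih =>
      have := hZ m hm
      rw [Finset.sum_range_succ]
      linarith
  obtain ⟨m, hm1, hm2⟩ := ((hd.eventually_gt_atTop (Z K + ∑ k ∈ Finset.range K, d k)).and
    (eventually_ge_atTop K)).exists
  exact ⟨m, by have := h1 m hm2; linarith⟩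

namespace BilevelProblem

variable {n : ℕ} {P : BilevelProblem n}

/-- A sequence of energies `Z k xs`, one for each solution `xs`, controlling the distance of the
points `w k` to `xs`, such that the decrease of the energy is governed by the values at `y k`. -/
structure EnergyDecrease (P : BilevelProblem n) (σ τ ω : ℕ → ℝ)
    (y w : ℕ → EuclideanSpace ℝ (Fin n)) (Z : ℕ → EuclideanSpace ℝ (Fin n) → ℝ) : Prop where
  σ_nonneg : ∀ k, 0 ≤ σ k
  τ_nonneg : ∀ k, 0 ≤ τ k
  ω_nonneg : ∀ k, 0 ≤ ω k
  mem_dom : ∀ k, y k ∈ P.dom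
  decrease : ∀ k, ∀ xs ∈ P.X₁, Z (k + 1) xs ≤ Z k xs -
    τ k * (σ k * (P.val₁ (y k) - P.val₁ xs) + (P.val₂ (y k) - P.val₂ xs))
  lower : ∀ k, ∀ xs ∈ P.X₁, ‖w k - xs‖ ^ 2 / 2 ≤ Z k xs
  upper : ∀ k, ∀ xs ∈ P.X₁, Z (k + 1) xs ≤ (‖y k - xs‖ + ω k) ^ 2 / 2 + ω k

namespace EnergyDecrease

variable {σ τ ω : ℕ → ℝ} {y w : ℕ → EuclideanSpace ℝ (Fin n)}
  {Z : ℕ → EuclideanSpace ℝ (Fin n) → ℝ}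

theorem nonneg (h : P.EnergyDecrease σ τ ω y w Z) (k : ℕ) {xs : EuclideanSpace ℝ (Fin n)}
    (hxs : xs ∈ P.X₁) : 0 ≤ Z k xs :=
  le_trans (by positivity) (h.lower k xs hxs)

/-- The lower level gap is always nonnegative, so only a negative upper level gap can raise the
energy. -/
theorem succ_le (h : P.EnergyDecrease σ τ ω y w Z) (hP : P.BasicAssumption) {k : ℕ}
    {xs : EuclideanSpace ℝ (Fin n)} (hxs : xs ∈ P.X₁) (hk : P.val₁ xs ≤ P.val₁ (y k)) :
    Z (k + 1) xs ≤ Z k xs := by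
  have h1 := h.decrease k xs hxs
  have h2 := val₂_le_of_mem_X₁ hP hxs (h.mem_dom k)
  have h3 := mul_nonneg (h.τ_nonneg k)
    (add_nonneg (mul_nonneg (h.σ_nonneg k) (sub_nonneg.2 hk)) (sub_nonneg.2 h2))
  linarith

/-- Either the energy does not increase, or `y k` beats the optimal upper level value. In the second
case `y k` lies in a bounded level set and `upper` caps the next energy. -/
theorem exists_bound (h : P.EnergyDecrease σ τ ω y w Z) (hP : P.BasicAssumption) {Ω V : ℝ}
    (hω : ∀ k, ω k ≤ Ω) (hV : ∀ k, P.val₂ (y k) ≤ V) : ∃ R : ℝ, ∀ k, ‖w k‖ ≤ R := by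
  obtain ⟨xs, hxs⟩ := hP.X₁_nonempty
  have hM : 0 ≤ V - P.val₂ xs := by
    have := val₂_le_of_mem_X₁ hP hxs (h.mem_dom 0)
    have := hV 0
    linarith
  obtain ⟨R, hR⟩ := exists_levelSet_bound hP hxs (V - P.val₂ xs)
  set K := max (Z 0 xs) ((R + Ω) ^ 2 / 2 + Ω) with hK
  have hZ : ∀ k, Z k xs ≤ K := by
    intro k
    induction k with
    | zero => exact le_max_left _ _
    | succ k ih =>
      rcases le_or_gt (P.val₁ xs) (P.val₁ (y k)) with hk | hk
      · exact (h.succ_le hP hxs hk).trans ih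
      · refine le_trans ?_ (le_max_right _ _)
        refine (h.upper k xs hxs).trans ?_
        have h1 := hR (y k) (h.mem_dom k) (by linarith) (by have := hV k; linarith)
        have h2 := hω k
        have h3 := h.ω_nonneg k
        gcongr
  refine ⟨2 * K + 1 + ‖xs‖, fun k => ?_⟩
  have h1 := (h.lower k xs hxs).trans (hZ k)
  have h2 := norm_add_le (w k - xs) xs
  rw [sub_add_cancel] at h2
  nlinarith [sq_nonneg (‖w k - xs‖ - 1)]

/-- If the penalized gaps are nonincreasing, then they vanish in the limit. -/
theorem tendsto_gap (h : P.EnergyDecrease σ τ ω y w Z) (hP : P.BasicAssumption) {m c : ℝ}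
    (hm : ∀ x ∈ P.dom, m ≤ P.val₁ x) {xs : EuclideanSpace ℝ (Fin n)} (hxs : xs ∈ P.X₁)
    (hE : Antitone fun k => σ k * (P.val₁ (y k) - m) + (P.val₂ (y k) - P.val₂ xs))
    (hc : 0 < c) (hτ : ∀ k, c ≤ τ k) (hσ : Tendsto σ atTop (𝓝 0)) :
    Tendsto (fun k => σ k * (P.val₁ (y k) - m) + (P.val₂ (y k) - P.val₂ xs)) atTop (𝓝 0) := by
  have hE0 : ∀ k, 0 ≤ σ k * (P.val₁ (y k) - m) + (P.val₂ (y k) - P.val₂ xs) := fun k =>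
    add_nonneg (mul_nonneg (h.σ_nonneg k) (sub_nonneg.2 (hm _ (h.mem_dom k))))
      (sub_nonneg.2 (val₂_le_of_mem_X₁ hP hxs (h.mem_dom k)))
  set E := fun k => σ k * (P.val₁ (y k) - m) + (P.val₂ (y k) - P.val₂ xs) with hEdef
  have key : ∀ ε : ℝ, 0 < ε → ∃ k, E k < ε := by
    intro ε hε
    by_contra! hcon
    -- The gap measured from `m` and the gap measured from `P.val₁ xs` differ by this vanishing
    -- quantity. If the former stayed above `ε`, each late step would cost at least `c ε / 2` of
    -- energy.
    have hlim : Tendsto (fun k => σ k * (P.val₁ xs - m)) atTop (𝓝 0) := by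
      simpa using hσ.mul_const (P.val₁ xs - m)
    obtain ⟨K, hK⟩ := eventually_atTop.1 (hlim.eventually (gt_mem_nhds (half_pos hε)))
    obtain ⟨k, hk⟩ := exists_neg_of_le_sub (Z := fun k => Z k xs) (K := K)
      (d := fun _ => c * (ε / 2)) (fun k hk => by
        have h1 := h.decrease k xs hxs
        have h2 := hcon k
        have h3 := hK k hk
        have h4 : ε / 2 ≤ σ k * (P.val₁ (y k) - P.val₁ xs) + (P.val₂ (y k) - P.val₂ xs) := by
          simp only [hEdef] at h2
          nlinarith
        have h5 := mul_le_mul (hτ k) h4 (by positivity) (h.τ_nonneg k)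
        linarith) (by
          simp only [Finset.sum_const, Finset.card_range, nsmul_eq_mul]
          exact tendsto_natCast_atTop_atTop.atTop_mul_const (by positivity))
    exact absurd (h.nonneg k hxs) (not_le.2 hk)
  rw [Metric.tendsto_atTop]
  intro ε hε
  obtain ⟨K, hK⟩ := key ε hε
  refine ⟨K, fun k hk => ?_⟩
  rw [Real.dist_eq, sub_zero, abs_of_nonneg (hE0 k)]
  exact (hE hk).trans_lt hK

/-- The energy is measured from a solution close to `y k`, which changes with `k`; this is why the
energies are indexed by all solutions. -/
theorem exists_near (h : P.EnergyDecrease σ τ ω y w Z) (hP : P.BasicAssumption)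
    {xs : EuclideanSpace ℝ (Fin n)} (hxs : xs ∈ P.X₁) (hω : Tendsto ω atTop (𝓝 0))
    (hv : Tendsto (fun k => P.val₂ (y k)) atTop (𝓝 (P.val₂ xs))) {ε : ℝ} (hε : 0 < ε) :
    ∃ δ : ℝ, 0 < δ ∧ ∃ K, ∀ k, K ≤ k → P.val₁ (y k) ≤ P.val₁ xs + δ →
      ∃ z ∈ P.X₁, Z (k + 1) z ≤ ε := by
  -- With distance and error both at most `r ≤ 1`, `upper` gives at most `(2r)² / 2 + r ≤ 3r < ε`.
  set r := min 1 (ε / 4) with hr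
  have hr0 : 0 < r := by positivity
  have hr1 : r ≤ 1 := min_le_left _ _
  have hr2 : r ≤ ε / 4 := min_le_right _ _
  obtain ⟨δ, hδ, hδ'⟩ := exists_levelSet_near hP hxs hr0
  obtain ⟨K, hK⟩ := eventually_atTop.1 ((hω.eventually (gt_mem_nhds hr0)).and
    (hv.eventually (gt_mem_nhds (lt_add_of_pos_right _ hδ))))
  refine ⟨δ, hδ, K, fun k hk hk1 => ?_⟩
  obtain ⟨z, hz, hyz⟩ := hδ' (y k) (h.mem_dom k) hk1 (hK k hk).2.le
  refine ⟨z, hz, (h.upper k z hz).trans ?_⟩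
  have h1 := (hK k hk).1
  have h2 := h.ω_nonneg k
  have h3 : ‖y k - z‖ + ω k ≤ 2 * r := by linarith
  have h4 : (‖y k - z‖ + ω k) ^ 2 ≤ (2 * r) ^ 2 := by gcongr
  nlinarith

/-- Divergence of `∑ σ` forces the upper level gap below `δ` at some late time, where the energy
from some solution is at most `ε`. This persists: if the upper level gap is nonnegative, the energy
from the same solution does not increase; if it is negative, `exists_near` supplies a new solution.
-/
theorem tendsto_infDist (h : P.EnergyDecrease σ τ ω y w Z) (hP : P.BasicAssumption)
    {xs : EuclideanSpace ℝ (Fin n)} (hxs : xs ∈ P.X₁) (hω : Tendsto ω atTop (𝓝 0))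
    (hv : Tendsto (fun k => P.val₂ (y k)) atTop (𝓝 (P.val₂ xs))) {c : ℝ}
    (hc : 0 < c) (hτ : ∀ k, c ≤ τ k)
    (hσ : Tendsto (fun m => ∑ k ∈ Finset.range m, σ k) atTop atTop) :
    Tendsto (fun k => Metric.infDist (w k) P.X₁) atTop (𝓝 0) := by
  have key : ∀ ε : ℝ, 0 < ε → ∃ K, ∀ k, K ≤ k → ∃ z ∈ P.X₁, Z k z ≤ ε := by
    intro ε hε
    obtain ⟨δ, hδ, K, hK⟩ := h.exists_near hP hxs hω hv hε
    have hex : ∃ k, K ≤ k ∧ P.val₁ (y k) ≤ P.val₁ xs + δ := by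
      by_contra! hcon
      obtain ⟨k, hk⟩ := exists_neg_of_le_sub (Z := fun k => Z k xs) (K := K)
        (d := fun k => c * δ * σ k) (fun k hk => by
          have h1 := h.decrease k xs hxs
          have h2 := val₂_le_of_mem_X₁ hP hxs (h.mem_dom k)
          have h3 := hcon k hk
          have h4 : σ k * δ ≤ σ k * (P.val₁ (y k) - P.val₁ xs) + (P.val₂ (y k) - P.val₂ xs) := by
            have := mul_le_mul_of_nonneg_left h3.le (h.σ_nonneg k)
            linarith
          have h5 := mul_le_mul (hτ k) h4 (mul_nonneg (h.σ_nonneg k) hδ.le) (h.τ_nonneg k)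
          linarith) (by
            simp only [← Finset.mul_sum]
            exact hσ.const_mul_atTop (by positivity))
      exact absurd (h.nonneg k hxs) (not_le.2 hk)
    obtain ⟨k₀, hk₀, hk₀'⟩ := hex
    refine ⟨k₀ + 1, fun k hk => ?_⟩
    induction k, hk using Nat.le_induction with
    | base => exact hK k₀ hk₀ hk₀'
    | succ k hk ih =>
      rcases le_or_gt (P.val₁ xs) (P.val₁ (y k)) with h1 | h1
      · obtain ⟨z, hz, hzε⟩ := ih
        refine ⟨z, hz, (h.succ_le hP hz ?_).trans hzε⟩
        rwa [val₁_eq_of_mem_X₁ hP hz hxs]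
      · exact hK k (by omega) (by linarith)
  rw [Metric.tendsto_atTop]
  intro ε hε
  obtain ⟨K, hK⟩ := key (ε ^ 2 / 4) (by positivity)
  refine ⟨K, fun k hk => ?_⟩
  rw [Real.dist_eq, sub_zero, abs_of_nonneg Metric.infDist_nonneg]
  obtain ⟨z, hz, hzε⟩ := hK k hk
  refine (Metric.infDist_le_dist_of_mem hz).trans_lt ?_
  rw [dist_eq_norm]
  have h1 := (h.lower k z hz).trans hzε
  by_contra! hcon
  have h2 : ε ^ 2 ≤ ‖w k - z‖ ^ 2 := by gcongr
  have h3 : 0 < ε ^ 2 := by positivity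
  linarith

end EnergyDecrease

theorem isBounded_range_of_tendsto_infDist (hP : P.BasicAssumption)
    {x : ℕ → EuclideanSpace ℝ (Fin n)}
    (hx : Tendsto (fun k => Metric.infDist (x k) P.X₁) atTop (𝓝 0)) :
    Bornology.IsBounded (Set.range x) := by
  obtain ⟨R, hR⟩ := isBounded_iff_forall_norm_le.1 hP.X₁_compact.isBounded
  obtain ⟨b, hb⟩ := hx.bddAbove_range
  refine isBounded_iff_forall_norm_le.2 ⟨b + R, ?_⟩
  rintro _ ⟨k, rfl⟩
  obtain ⟨z, hz, hdz⟩ := hP.X₁_compact.exists_infDist_eq_dist hP.X₁_nonempty (x k)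
  have h1 := hR z hz
  have h2 : Metric.infDist (x k) P.X₁ ≤ b := hb (Set.mem_range_self k)
  have h3 := norm_add_le (x k - z) z
  rw [sub_add_cancel, ← dist_eq_norm] at h3
  linarith

theorem mem_X₁_of_mapClusterPt (hP : P.BasicAssumption) {x : ℕ → EuclideanSpace ℝ (Fin n)}
    (hx : Tendsto (fun k => Metric.infDist (x k) P.X₁) atTop (𝓝 0))
    {z : EuclideanSpace ℝ (Fin n)} (hz : MapClusterPt z atTop x) : z ∈ P.X₁ := by
  obtain ⟨s, hs, hsz⟩ := MapClusterPt.tendsto_subseq hz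
  have h1 : Tendsto (fun k => Metric.infDist (x (s k)) P.X₁) atTop
      (𝓝 (Metric.infDist z P.X₁)) :=
    ((Metric.continuous_infDist_pt P.X₁).tendsto z).comp hsz
  have h2 := tendsto_nhds_unique h1 (hx.comp hs.tendsto_atTop)
  have h3 := (Metric.mem_closure_iff_infDist_zero hP.X₁_nonempty).2 h2
  rwa [hP.X₁_compact.isClosed.closure_eq] at h3

theorem ConvergesToSolutions.of_tendsto_infDist (hP : P.BasicAssumption)
    {x : ℕ → EuclideanSpace ℝ (Fin n)}
    (hx : Tendsto (fun k => Metric.infDist (x k) P.X₁) atTop (𝓝 0)) :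
    P.ConvergesToSolutions x :=
  ⟨isBounded_range_of_tendsto_infDist hP hx, fun _ hz => mem_X₁_of_mapClusterPt hP hx hz, hx⟩

end BilevelProblem

/-! ### Penalty sequences. -/

namespace IsPenaltySeq

variable {σ : ℕ → ℝ}

theorem pos' (h : IsPenaltySeq σ) (k : ℕ) : 0 < σ k := by
  induction k with
  | zero => exact h.pos
  | succ k ih => exact lt_of_lt_of_le (by positivity) (h.mem k).1

theorem succ_le (h : IsPenaltySeq σ) (k : ℕ) : σ (k + 1) ≤ σ k := (h.mem k).2

theorem le_zero (h : IsPenaltySeq σ) (k : ℕ) : σ k ≤ σ 0 :=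
  antitone_nat_of_succ_le h.succ_le (Nat.zero_le k)

theorem tendsto_sum_shift (h : IsPenaltySeq σ) (j : ℕ) :
    Tendsto (fun m => ∑ k ∈ Finset.range m, σ (k + j)) atTop atTop := by
  induction j with
  | zero => simpa using h.sum_eq_top
  | succ j ih =>
    have h1 : ∀ m, ∑ k ∈ Finset.range m, σ (k + (j + 1))
        = ∑ k ∈ Finset.range (m + 1), σ (k + j) - σ j := by
      intro m
      rw [Finset.sum_range_succ']
      simp [add_comm, add_left_comm]
    simp only [h1, sub_eq_add_neg]
    exact tendsto_atTop_add_const_right _ _ (ih.comp (tendsto_add_atTop_nat 1))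

end IsPenaltySeq

namespace BilevelProblem

variable {n : ℕ} {P : BilevelProblem n}

/-! ### Inequalities for a single step. -/

section Inequalities

variable {σ α : ℝ} {x z : EuclideanSpace ℝ (Fin n)}

/-- Decrease of the penalized cost along a proximal gradient step. -/
theorem IsProxGradStep.sq_sub_inner_le (hP : P.BasicAssumption)
    (hσ : 0 < σ) (hα : 0 < α) (h : P.IsProxGradStep σ α x z)
    (hx : x ∈ P.dom) :
    ‖x - z‖ ^ 2 - α * inner ℝ (∇ (P.f σ) x - ∇ (P.f σ) z) (x - z) ≤
      α * (σ * (P.val₁ x - P.val₁ z) + (P.val₂ x - P.val₂ z)) := by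
  have h1 := h.inner_le hP hσ hα hx
  have h2 := (f_convex hP hσ.le).add_inner_gradient_le (f_differentiable hP σ) z x
  have h3 := mul_le_mul_of_nonneg_left h2 hα.le
  have h4 : inner ℝ (x - α • ∇ (P.f σ) x - z) (x - z)
      = ‖x - z‖ ^ 2 - α * inner ℝ (∇ (P.f σ) x) (x - z) := by
    rw [sub_right_comm, inner_sub_left, real_inner_self_eq_norm_sq, inner_smul_left]
    simp
  rw [h4] at h1
  simp only [inner_sub_left _ _ (x - z), val₁, val₂, f] at *
  linarith

theorem IsProxGradStep.val_le (hP : P.BasicAssumption)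
    (hσ : 0 < σ) (hα : 0 < α) (h : P.IsProxGradStep σ α x z)
    (hx : x ∈ P.dom)
    (hl : α * inner ℝ (∇ (P.f σ) x - ∇ (P.f σ) z) (x - z) ≤ ‖x - z‖ ^ 2) :
    σ * P.val₁ z + P.val₂ z ≤ σ * P.val₁ x + P.val₂ x := by
  have h1 := h.sq_sub_inner_le hP hσ hα hx
  have h2 : 0 ≤ α * (σ * (P.val₁ x - P.val₁ z) + (P.val₂ x - P.val₂ z)) := by linarith
  have h3 := nonneg_of_mul_nonneg_right h2 hα
  linarith

/-- The basic inequality of the proximal gradient method with a sufficiently small stepsize. -/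
theorem IsProxGradStep.half_sq_le (hP : P.BasicAssumption)
    (hσ : 0 < σ) (hα : 0 < α) (h : P.IsProxGradStep σ α x z)
    (hl : α * (P.f σ z - P.f σ x - inner ℝ (∇ (P.f σ) x) (z - x)) ≤ ‖z - x‖ ^ 2 / 2)
    {w : EuclideanSpace ℝ (Fin n)} (hw : w ∈ P.dom) :
    ‖z - w‖ ^ 2 / 2 ≤ ‖x - w‖ ^ 2 / 2 -
      α * (σ * (P.val₁ z - P.val₁ w) + (P.val₂ z - P.val₂ w)) := by
  have h1 := h.inner_le hP hσ hα hw
  have h2 := (f_convex hP hσ.le).add_inner_gradient_le (f_differentiable hP σ) x w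
  have h3 := mul_le_mul_of_nonneg_left h2 hα.le
  have h4 : inner ℝ (x - α • ∇ (P.f σ) x - z) (w - z)
      = inner ℝ (x - z) (w - z) - α * inner ℝ (∇ (P.f σ) x) (w - z) := by
    rw [sub_right_comm, inner_sub_left, inner_smul_left]
    simp
  have h5 : ‖x - w‖ ^ 2 = ‖z - x‖ ^ 2 - 2 * inner ℝ (x - z) (w - z) + ‖z - w‖ ^ 2 := by
    have : x - w = (x - z) - (w - z) := by abel
    rw [this, norm_sub_sq_real, norm_sub_rev x z, norm_sub_rev w z]
  have h6 : inner ℝ (∇ (P.f σ) x) (w - z)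
      = inner ℝ (∇ (P.f σ) x) (w - x) - inner ℝ (∇ (P.f σ) x) (z - x) := by
    rw [← inner_sub_right]
    congr 1
    abel
  rw [h4, h6] at h1
  simp only [val₁, val₂, f] at *
  linarith

end Inequalities

/-! ### staBiM. -/

section Static

variable {ν : ℝ} {L₁ L₂ : ℝ≥0} {σ : ℕ → ℝ} {x : ℕ → EuclideanSpace ℝ (Fin n)}

theorem lipschitz_gradient_f (hP : P.BasicAssumption) (h₁ : LipschitzWith L₁ (∇ P.f₁))
    (h₂ : LipschitzWith L₂ (∇ P.f₂)) {s : ℝ} (hs : 0 ≤ s) (u v : EuclideanSpace ℝ (Fin n)) :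
    ‖∇ (P.f s) u - ∇ (P.f s) v‖ ≤ (s * L₁ + L₂) * ‖u - v‖ := by
  rw [gradient_f hP, gradient_f hP]
  have h3 : s • ∇ P.f₁ u + ∇ P.f₂ u - (s • ∇ P.f₁ v + ∇ P.f₂ v)
      = s • (∇ P.f₁ u - ∇ P.f₁ v) + (∇ P.f₂ u - ∇ P.f₂ v) := by module
  rw [h3]
  refine (norm_add_le _ _).trans ?_
  rw [norm_smul, Real.norm_of_nonneg hs]
  have h4 := mul_le_mul_of_nonneg_left (h₁.norm_sub_le u v) hs
  have h5 := h₂.norm_sub_le u v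
  linarith

theorem penalized_modulus_pos (hL : 0 < L₁ + L₂) {s : ℝ} (hs : 0 < s) :
    0 < s * (L₁ : ℝ) + L₂ := by
  have h0 : (0 : ℝ) < L₁ + L₂ := by exact_mod_cast hL
  rcases eq_or_lt_of_le L₁.coe_nonneg with h | h
  · rw [← h] at h0 ⊢
    linarith
  · have := mul_pos hs h
    have := L₂.coe_nonneg
    linarith

theorem exists_isStaBiM (hP : P.BasicAssumption) (hσ : IsPenaltySeq σ) (hν : 0 < ν)
    (hL : 0 < L₁ + L₂) (x₀ : EuclideanSpace ℝ (Fin n)) : ∃ x, P.IsStaBiM ν L₁ L₂ σ x₀ x := by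
  have hstep : ∀ (k : ℕ) (u : EuclideanSpace ℝ (Fin n)), ∃ z,
      P.IsProxGradStep (σ (k + 1)) (ν / (σ (k + 1) * L₁ + L₂)) u z := fun k u =>
    exists_isProxGradStep hP (hσ.pos' _) (div_pos hν (penalized_modulus_pos hL (hσ.pos' _))) u
  choose T hT using hstep
  exact ⟨fun k => Nat.rec x₀ (fun k u => T k u) k, rfl, fun k => hT k _⟩

/-- The energy inequality for staBiM, and the monotonicity of its penalized costs. -/
theorem IsStaBiM.step (hP : P.BasicAssumption) (hσ : IsPenaltySeq σ) (hν : ν ∈ Set.Ioo (0 : ℝ) 1)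
    (h₁ : LipschitzWith L₁ (∇ P.f₁)) (h₂ : LipschitzWith L₂ (∇ P.f₂)) (hL : 0 < L₁ + L₂)
    {x₀ : EuclideanSpace ℝ (Fin n)} (h : P.IsStaBiM ν L₁ L₂ σ x₀ x) (k : ℕ) :
    (∀ w ∈ P.dom, ‖x (k + 1) - w‖ ^ 2 / 2 ≤ ‖x k - w‖ ^ 2 / 2 -
      ν / (σ (k + 1) * L₁ + L₂) * (σ (k + 1) * (P.val₁ (x (k + 1)) - P.val₁ w)
        + (P.val₂ (x (k + 1)) - P.val₂ w))) ∧
    (x k ∈ P.dom → σ (k + 1) * P.val₁ (x (k + 1)) + P.val₂ (x (k + 1))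
      ≤ σ (k + 1) * P.val₁ (x k) + P.val₂ (x k)) := by
  have hpos := hσ.pos' (k + 1)
  set L := σ (k + 1) * (L₁ : ℝ) + L₂ with hLdef
  have hL0 : 0 < L := penalized_modulus_pos hL hpos
  have hα : 0 < ν / L := div_pos hν.1 hL0
  have hαL : ν / L * L = ν := div_mul_cancel₀ _ hL0.ne'
  have hlip := lipschitz_gradient_f hP h₁ h₂ hpos.le
  constructor
  · intro w hw
    refine (h.x_succ k).half_sq_le hP hpos hα ?_ hw
    have h3 := le_add_inner_gradient_add_of_lipschitz (f_differentiable hP (σ (k + 1))) hlip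
      (x k) (x (k + 1))
    have h4 : P.f (σ (k + 1)) (x (k + 1)) - P.f (σ (k + 1)) (x k)
        - inner ℝ (∇ (P.f (σ (k + 1))) (x k)) (x (k + 1) - x k)
        ≤ L / 2 * ‖x (k + 1) - x k‖ ^ 2 := by linarith
    refine (mul_le_mul_of_nonneg_left h4 hα.le).trans ?_
    have h5 : ν / L * (L / 2 * ‖x (k + 1) - x k‖ ^ 2) = ν * (‖x (k + 1) - x k‖ ^ 2 / 2) := by
      field_simp
    rw [h5]
    exact mul_le_of_le_one_left (by positivity) hν.2.le
  · intro hx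
    refine (h.x_succ k).val_le hP hpos hα hx ?_
    have h3 : inner ℝ (∇ (P.f (σ (k + 1))) (x k) - ∇ (P.f (σ (k + 1))) (x (k + 1)))
        (x k - x (k + 1)) ≤ L * ‖x k - x (k + 1)‖ * ‖x k - x (k + 1)‖ :=
      (real_inner_le_norm _ _).trans (mul_le_mul_of_nonneg_right (hlip _ _) (norm_nonneg _))
    refine (mul_le_mul_of_nonneg_left h3 hα.le).trans ?_
    have h5 : ν / L * (L * ‖x k - x (k + 1)‖ * ‖x k - x (k + 1)‖)
        = ν / L * L * ‖x k - x (k + 1)‖ ^ 2 := by ring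
    rw [h5, hαL]
    exact mul_le_of_le_one_left (by positivity) hν.2.le

/-- Vanishing of the penalized gaps forces convergence of the lower level values. -/
theorem tendsto_val₂_of_gap (hP : P.BasicAssumption) {s : ℕ → ℝ} (hs : ∀ k, 0 ≤ s k)
    {y : ℕ → EuclideanSpace ℝ (Fin n)} (hy : ∀ k, y k ∈ P.dom) {m : ℝ}
    (hm : ∀ x ∈ P.dom, m ≤ P.val₁ x) {xs : EuclideanSpace ℝ (Fin n)} (hxs : xs ∈ P.X₁)
    (h : Tendsto (fun k => s k * (P.val₁ (y k) - m) + (P.val₂ (y k) - P.val₂ xs)) atTop (𝓝 0)) :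
    Tendsto (fun k => P.val₂ (y k)) atTop (𝓝 (P.val₂ xs)) := by
  have h1 : Tendsto (fun k => P.val₂ (y k) - P.val₂ xs) atTop (𝓝 0) := by
    refine squeeze_zero (fun k => sub_nonneg.2 (val₂_le_of_mem_X₁ hP hxs (hy k))) (fun k => ?_) h
    have := mul_nonneg (hs k) (sub_nonneg.2 (hm _ (hy k)))
    linarith
  simpa using h1.add_const (P.val₂ xs)

theorem IsStaBiM.convergesToSolutions (hP : P.BasicAssumption) (hσ : IsPenaltySeq σ)
    (hν : ν ∈ Set.Ioo (0 : ℝ) 1)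
    (h₁ : LipschitzWith L₁ (∇ P.f₁)) (h₂ : LipschitzWith L₂ (∇ P.f₂)) (hL : 0 < L₁ + L₂)
    {x₀ : EuclideanSpace ℝ (Fin n)} (h : P.IsStaBiM ν L₁ L₂ σ x₀ x) :
    P.ConvergesToSolutions x := by
  have hpos := hσ.pos'
  have hmod := fun k => penalized_modulus_pos hL (hpos k)
  have hdom : ∀ k, x (k + 1) ∈ P.dom := fun k => (h.x_succ k).mem_dom hP (hpos _)
  have hstep := h.step hP hσ hν h₁ h₂ hL
  -- The decrease involves the costs at the new iterate, so `y k = x (k + 1)`. The next energy is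
  -- exactly half the squared distance from `y k`, hence `ω = 0`.
  have hen : P.EnergyDecrease (fun k => σ (k + 1)) (fun k => ν / (σ (k + 1) * L₁ + L₂))
      (fun _ => 0) (fun k => x (k + 1)) x (fun k w => ‖x k - w‖ ^ 2 / 2) :=
    { σ_nonneg := fun k => (hpos _).le
      τ_nonneg := fun k => (div_pos hν.1 (hmod _)).le
      ω_nonneg := fun k => le_rfl
      mem_dom := hdom
      decrease := fun k xs hxs => (hstep k).1 xs (mem_dom_of_mem_X₁ hxs)
      lower := fun k xs hxs => le_rfl
      upper := fun k xs hxs => by simp }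
  obtain ⟨xs, hxs⟩ := hP.X₁_nonempty
  obtain ⟨m, hm⟩ := exists_le_val₁ hP
  have hc : 0 < ν / (σ 0 * L₁ + L₂) := div_pos hν.1 (hmod 0)
  have hτ : ∀ k, ν / (σ 0 * L₁ + L₂) ≤ ν / (σ (k + 1) * L₁ + L₂) := by
    intro k
    have h3 := hσ.le_zero (k + 1)
    have h4 := hmod (k + 1)
    exact div_le_div_of_nonneg_left hν.1.le h4 (by gcongr)
  -- A step lowers the cost with its own penalty, and lowering `σ` lowers `σ (φ₁ - m)` because `φ₁ ≥
  -- m`.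
  have hanti : Antitone fun k =>
      σ (k + 1) * (P.val₁ (x (k + 1)) - m) + (P.val₂ (x (k + 1)) - P.val₂ xs) := by
    refine antitone_nat_of_succ_le fun k => ?_
    have h3 := (hstep (k + 1)).2 (hdom k)
    have h4 := mul_le_mul_of_nonneg_right (hσ.succ_le (k + 1)) (sub_nonneg.2 (hm _ (hdom k)))
    linarith
  have hgap := hen.tendsto_gap hP hm hxs hanti hc hτ
    (hσ.tendsto_zero.comp (tendsto_add_atTop_nat 1))
  exact .of_tendsto_infDist hP (hen.tendsto_infDist hP hxs tendsto_const_nhds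
    (tendsto_val₂_of_gap hP (fun k => (hpos _).le) hdom hm hxs hgap) hc hτ
    (hσ.tendsto_sum_shift 1))

end Static

end BilevelProblem

/-! ### The local Lipschitz and cocoercivity estimates. -/

section Estimates

variable {n : ℕ} {F : EuclideanSpace ℝ (Fin n) → ℝ} {u v : EuclideanSpace ℝ (Fin n)}

theorem lipEst_mul_sq (F : EuclideanSpace ℝ (Fin n) → ℝ) (u v : EuclideanSpace ℝ (Fin n)) :
    lipEst F u v * ‖u - v‖ ^ 2 = inner ℝ (∇ F u - ∇ F v) (u - v) := by
  rcases eq_or_ne u v with rfl | h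
  · simp [lipEst]
  · have : ‖u - v‖ ≠ 0 := norm_ne_zero_iff.2 (sub_ne_zero.2 h)
    rw [lipEst]
    field_simp

theorem lipEst_nonneg (hc : ConvexOn ℝ Set.univ F) (hF : Differentiable ℝ F) :
    0 ≤ lipEst F u v :=
  div_nonneg (hc.inner_gradient_sub_nonneg hF u v) (by positivity)

theorem cocoEst_nonneg (hc : ConvexOn ℝ Set.univ F) (hF : Differentiable ℝ F) :
    0 ≤ cocoEst F u v :=
  div_nonneg (by positivity) (hc.inner_gradient_sub_nonneg hF u v)

/-- The convention `0 / 0 = 0` is harmless: when the inner product vanishes, convexity makes the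
gradients equal. -/
theorem lipEst_mul_cocoEst_mul_sq (hc : ConvexOn ℝ Set.univ F) (hF : Differentiable ℝ F) :
    lipEst F u v * cocoEst F u v * ‖u - v‖ ^ 2 = ‖∇ F u - ∇ F v‖ ^ 2 := by
  rw [mul_right_comm, lipEst_mul_sq, cocoEst]
  rcases eq_or_ne (inner ℝ (∇ F u - ∇ F v) (u - v)) 0 with h | h
  · rw [h, hc.gradient_eq_of_inner_eq_zero hF h]
    simp
  · field_simp

theorem lipEst_le_of_lipschitz {L : ℝ} (hL : 0 ≤ L) (h : ‖∇ F u - ∇ F v‖ ≤ L * ‖u - v‖) :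
    lipEst F u v ≤ L := by
  rw [lipEst]
  refine div_le_of_le_mul₀ (by positivity) hL ?_
  refine (real_inner_le_norm _ _).trans ?_
  nlinarith [norm_nonneg (u - v)]

/-- The quantity `α ℓ [α c - 1]₊` entering the second stepsize bound. -/
noncomputable def excess (F : EuclideanSpace ℝ (Fin n) → ℝ) (α : ℝ) (u v : EuclideanSpace ℝ (Fin n)) :
    ℝ :=
  α * lipEst F u v * max (α * cocoEst F u v - 1) 0

theorem excess_nonneg (hc : ConvexOn ℝ Set.univ F) (hF : Differentiable ℝ F) {α : ℝ}
    (hα : 0 ≤ α) : 0 ≤ excess F α u v :=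
  mul_nonneg (mul_nonneg hα (lipEst_nonneg hc hF)) (le_max_right _ _)

/-- Without the positive part in `excess` this would be an identity. -/
theorem le_excess_mul_sq (hc : ConvexOn ℝ Set.univ F) (hF : Differentiable ℝ F) {α : ℝ}
    (hα : 0 ≤ α) :
    α ^ 2 * ‖∇ F u - ∇ F v‖ ^ 2 - α * inner ℝ (∇ F u - ∇ F v) (u - v) ≤
      excess F α u v * ‖u - v‖ ^ 2 := by
  rw [← lipEst_mul_cocoEst_mul_sq hc hF, ← lipEst_mul_sq, excess]
  have h1 : 0 ≤ α * lipEst F u v := mul_nonneg hα (lipEst_nonneg hc hF)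
  have h2 := mul_le_mul_of_nonneg_left (le_max_left (α * cocoEst F u v - 1) 0) h1
  have h3 := mul_le_mul_of_nonneg_right h2 (by positivity : 0 ≤ ‖u - v‖ ^ 2)
  linarith

/-- Here `[α c - 1]₊ ≤ α c` and `ℓ c ≤ L²`. It makes the second stepsize bound at least a multiple
of `1 / L`. -/
theorem excess_le_sq (hc : ConvexOn ℝ Set.univ F) (hF : Differentiable ℝ F) {α L : ℝ}
    (hα : 0 ≤ α) (h : ‖∇ F u - ∇ F v‖ ≤ L * ‖u - v‖) :
    excess F α u v ≤ (α * L) ^ 2 := by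
  have hl : 0 ≤ lipEst F u v := lipEst_nonneg hc hF
  have hco : 0 ≤ cocoEst F u v := cocoEst_nonneg hc hF
  have h1 : excess F α u v ≤ α * lipEst F u v * (α * cocoEst F u v) := by
    rw [excess]
    refine mul_le_mul_of_nonneg_left (max_le (by linarith) (by positivity)) (by positivity)
  have h2 : lipEst F u v * cocoEst F u v ≤ L ^ 2 := by
    rcases eq_or_ne u v with rfl | huv
    · simp [lipEst]
      positivity
    · have h3 : 0 < ‖u - v‖ := norm_pos_iff.2 (sub_ne_zero.2 huv)
      refine le_of_mul_le_mul_right ?_ (by positivity : 0 < ‖u - v‖ ^ 2)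
      rw [lipEst_mul_cocoEst_mul_sq hc hF, ← mul_pow]
      gcongr
  nlinarith [mul_le_mul_of_nonneg_left h2 (by positivity : 0 ≤ α ^ 2)]

end Estimates

namespace BilevelProblem

variable {n : ℕ} {P : BilevelProblem n}

theorem inner_gradient_f_sub (hP : P.BasicAssumption) (σ : ℝ) (u v d : EuclideanSpace ℝ (Fin n)) :
    inner ℝ (∇ (P.f σ) u - ∇ (P.f σ) v) d
      = σ * inner ℝ (∇ P.f₁ u - ∇ P.f₁ v) d + inner ℝ (∇ P.f₂ u - ∇ P.f₂ v) d := by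
  rw [gradient_f hP, gradient_f hP]
  have h3 : σ • ∇ P.f₁ u + ∇ P.f₂ u - (σ • ∇ P.f₁ v + ∇ P.f₂ v)
      = σ • (∇ P.f₁ u - ∇ P.f₁ v) + (∇ P.f₂ u - ∇ P.f₂ v) := by module
  rw [h3, inner_add_left, inner_smul_left]
  simp

theorem lipEst_f₂_le (hP : P.BasicAssumption) {σ : ℝ} (hσ : 0 ≤ σ)
    (u v : EuclideanSpace ℝ (Fin n)) : lipEst P.f₂ u v ≤ lipEst (P.f σ) u v := by
  rw [lipEst, lipEst, inner_gradient_f_sub hP]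
  have := mul_nonneg hσ (hP.f₁_convex.inner_gradient_sub_nonneg
    (hP.f₁_contDiff.differentiable one_ne_zero) u v)
  gcongr
  linarith

theorem lipEst_f₂_nonneg (hP : P.BasicAssumption) (u v : EuclideanSpace ℝ (Fin n)) :
    0 ≤ lipEst P.f₂ u v :=
  lipEst_nonneg hP.f₂_convex (hP.f₂_contDiff.differentiable one_ne_zero)

/-- The radicand in the numerator of the second stepsize bound. -/
noncomputable def radicand (P : BilevelProblem n) (σp σ α : ℝ) (xp x : EuclideanSpace ℝ (Fin n)) :
    ℝ :=
  1 - 4 * (1 - σ / σp) * (α * lipEst P.f₂ xp x)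

/-! ### Bounds on the trial stepsize of adaBiM. -/

section Trial

variable {αmax σp σ σn αp α : ℝ} {xp x : EuclideanSpace ℝ (Fin n)}

theorem trialStepsize_eq :
    P.trialStepsize αmax σp σ σn αp α xp x =
      if 2 * √(excess (P.f σ) α xp x) = 0 then
        min (√(σ / σp * (1 + (σ * α) / (σp * αp))) * (σ / σn) * α) αmax
      else min (√(σ / σp * (1 + (σ * α) / (σp * αp))) * (σ / σn) * α)
        (min (√(P.radicand σp σ α xp x) / (2 * √(excess (P.f σ) α xp x)) * (σ / σn) * α) αmax) :=
  rfl

/-- The ratio `σ / σp ≥ 3/4` makes `4 (1 - σ / σp)` at most 1, and `α ℓ₂ ≤ α ℓ ≤ ν` by the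
linesearch test. The alternative `σp = σ` covers the first iterate, which has passed no test. -/
theorem one_sub_le_radicand (hP : P.BasicAssumption) (hσp : 0 < σp) (hσ : 0 < σ)
    (h1 : 3 / 4 * σp ≤ σ) (h2 : σ ≤ σp) (hα : 0 ≤ α) {ν : ℝ} (hν : 0 ≤ ν)
    (h : σp = σ ∨ α * lipEst (P.f σ) xp x ≤ ν) : 1 - ν ≤ P.radicand σp σ α xp x := by
  rw [radicand]
  rcases h with h | h
  · rw [h, div_self hσ.ne']
    linarith
  · have h3 : 3 / 4 ≤ σ / σp := by rwa [le_div_iff₀ hσp]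
    have h4 : σ / σp ≤ 1 := by rwa [div_le_one hσp]
    have h5 : α * lipEst P.f₂ xp x ≤ ν :=
      (mul_le_mul_of_nonneg_left (lipEst_f₂_le hP hσ.le xp x) hα).trans h
    have h6 : 0 ≤ α * lipEst P.f₂ xp x := mul_nonneg hα (lipEst_f₂_nonneg hP xp x)
    nlinarith

theorem trialStepsize_le_left : P.trialStepsize αmax σp σ σn αp α xp x ≤
    √(σ / σp * (1 + (σ * α) / (σp * αp))) * (σ / σn) * α := by
  rw [trialStepsize_eq]
  split_ifs <;> exact min_le_left _ _

theorem trialStepsize_le_max : P.trialStepsize αmax σp σ σn αp α xp x ≤ αmax := by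
  rw [trialStepsize_eq]
  split_ifs
  · exact min_le_right _ _
  · exact (min_le_right _ _).trans (min_le_right _ _)

theorem trialStepsize_pos (hσp : 0 < σp) (hσ : 0 < σ)
    (hσn : 0 < σn) (hαp : 0 < αp) (hα : 0 < α) (hmax : 0 < αmax)
    (hr : 0 < P.radicand σp σ α xp x) : 0 < P.trialStepsize αmax σp σ σn αp α xp x := by
  have h1 : 0 < √(σ / σp * (1 + (σ * α) / (σp * αp))) * (σ / σn) * α := by positivity
  rw [trialStepsize_eq]
  split_ifs with h
  · exact lt_min h1 hmax
  · have h2 : 0 < 2 * √(excess (P.f σ) α xp x) := lt_of_le_of_ne (by positivity) (Ne.symm h)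
    have h3 := Real.sqrt_pos.2 hr
    exact lt_min h1 (lt_min (by positivity) hmax)

/-- The second stepsize bound in the form used by the energy inequality. -/
theorem sq_mul_excess_le (hσ : 0 < σ) (hσn : 0 < σn) (hα : 0 < α)
    (hr : 0 ≤ P.radicand σp σ α xp x) (he : 0 ≤ excess (P.f σ) α xp x) {a : ℝ} (ha : 0 ≤ a)
    (h : a ≤ P.trialStepsize αmax σp σ σn αp α xp x) :
    (σn * a / (σ * α)) ^ 2 * excess (P.f σ) α xp x ≤ P.radicand σp σ α xp x / 4 := by
  rw [trialStepsize_eq] at h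
  split_ifs at h with h0
  · have h1 : √(excess (P.f σ) α xp x) = 0 := by linarith
    have h2 : excess (P.f σ) α xp x = 0 := by
      rw [← Real.sq_sqrt he, h1]
      norm_num
    rw [h2, mul_zero]
    positivity
  · have h1 : 0 < 2 * √(excess (P.f σ) α xp x) := lt_of_le_of_ne (by positivity) (Ne.symm h0)
    have h2 := h.trans ((min_le_right _ _).trans (min_le_left _ _))
    have h3 : σn * a / (σ * α) ≤ √(P.radicand σp σ α xp x) / (2 * √(excess (P.f σ) α xp x)) := by
      rw [div_le_iff₀ (by positivity)]
      have h4 := mul_le_mul_of_nonneg_left h2 hσn.le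
      refine h4.trans (le_of_eq ?_)
      field_simp
    rw [le_div_iff₀ h1] at h3
    have h4 : (σn * a / (σ * α) * (2 * √(excess (P.f σ) α xp x))) ^ 2
        ≤ √(P.radicand σp σ α xp x) ^ 2 := by
      gcongr
    rw [Real.sq_sqrt hr, mul_pow, mul_pow, Real.sq_sqrt he] at h4
    linarith

theorem ratio_le_of_le_trialStepsize (hσ : 0 < σ) (hσn : 0 < σn) (hα : 0 < α) {a : ℝ}
    (h : a ≤ P.trialStepsize αmax σp σ σn αp α xp x) :
    σn * a / (σ * α) ≤ √(σ / σp * (1 + (σ * α) / (σp * αp))) := by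
  rw [div_le_iff₀ (by positivity)]
  have h4 := mul_le_mul_of_nonneg_left (h.trans trialStepsize_le_left) hσn.le
  refine h4.trans (le_of_eq ?_)
  field_simp

/-- The factor `σ / σn ≥ 1` may be dropped, and `excess ≤ (α L)²` cancels `α` in the second term, so
only the growth term depends on the current stepsize. -/
theorem min_le_trialStepsize (hP : P.BasicAssumption) (hσ : 0 < σ)
    (hσn : 0 < σn) (hσσ : σn ≤ σ) (hα : 0 < α) {b L : ℝ} (hL : 0 < L)
    (hr : b ≤ P.radicand σp σ α xp x)
    (hlip : ‖∇ (P.f σ) xp - ∇ (P.f σ) x‖ ≤ L * ‖xp - x‖) :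
    min (min (√b / (2 * L)) αmax) (√(σ / σp * (1 + (σ * α) / (σp * αp))) * α)
      ≤ P.trialStepsize αmax σp σ σn αp α xp x := by
  have hq : 1 ≤ σ / σn := by rwa [one_le_div hσn]
  have h1 : √(σ / σp * (1 + (σ * α) / (σp * αp))) * α
      ≤ √(σ / σp * (1 + (σ * α) / (σp * αp))) * (σ / σn) * α := by
    have := mul_le_mul_of_nonneg_left hq
      (by positivity : 0 ≤ √(σ / σp * (1 + (σ * α) / (σp * αp))) * α)
    linarith
  have hfst := (min_le_right (min (√b / (2 * L)) αmax)
    (√(σ / σp * (1 + (σ * α) / (σp * αp))) * α)).trans h1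
  have hmax := (min_le_left (min (√b / (2 * L)) αmax)
    (√(σ / σp * (1 + (σ * α) / (σp * αp))) * α)).trans (min_le_right _ _)
  have hsnd := (min_le_left (min (√b / (2 * L)) αmax)
    (√(σ / σp * (1 + (σ * α) / (σp * αp))) * α)).trans (min_le_left _ _)
  rw [trialStepsize_eq]
  split_ifs with h0
  · exact le_min hfst hmax
  · refine le_min hfst (le_min (hsnd.trans ?_) hmax)
    have h2 : 0 < 2 * √(excess (P.f σ) α xp x) := lt_of_le_of_ne (by positivity) (Ne.symm h0)
    have h3 : √(excess (P.f σ) α xp x) ≤ α * L := by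
      rw [Real.sqrt_le_left (by positivity)]
      exact excess_le_sq (f_convex hP hσ.le) (f_differentiable hP σ) hα.le hlip
    have h4 : √b ≤ √(P.radicand σp σ α xp x) := Real.sqrt_le_sqrt hr
    have h5 : √b / (2 * L) ≤ √(P.radicand σp σ α xp x) / (2 * √(excess (P.f σ) α xp x)) * α := by
      rw [div_mul_eq_mul_div, div_le_div_iff₀ (by positivity) h2]
      have h6 : √b * (2 * √(excess (P.f σ) α xp x)) ≤ √b * (2 * (α * L)) := by gcongr
      have h7 : √b * (2 * (α * L)) ≤ √(P.radicand σp σ α xp x) * (2 * (α * L)) := by gcongr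
      linarith
    have h8 : 0 ≤ √(P.radicand σp σ α xp x) / (2 * √(excess (P.f σ) α xp x)) * α := by positivity
    have h9 := mul_le_mul_of_nonneg_left hq h8
    linarith

end Trial

/-- The energy inequality for two consecutive proximal gradient steps `xp ↦ x ↦ z` with parameters
`(σ, α)` and `(σ', α')`, where `a = α' σ' / σ` and `ρ = a / α`. -/
theorem IsProxGradStep.energy_le (hP : P.BasicAssumption) {σ σ' α α' a ρ : ℝ} (hσ : 0 < σ)
    (hσ' : 0 < σ') (hα : 0 < α) (hα' : 0 < α') (haσ : a * σ = α' * σ') (haα : a ≤ α')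
    (hρα : ρ * α = a) (hρ : 0 ≤ ρ) {xp x z xs : EuclideanSpace ℝ (Fin n)} (hxp : xp ∈ P.dom)
    (hx : P.IsProxGradStep σ α xp x) (hz : P.IsProxGradStep σ' α' x z) (hxs : xs ∈ P.X₁) {q : ℝ}
    (hq : ρ ^ 2 * (α ^ 2 * ‖∇ (P.f σ) xp - ∇ (P.f σ) x‖ ^ 2
      - α * inner ℝ (∇ (P.f σ) xp - ∇ (P.f σ) x) (xp - x)) ≤ q) :
    ‖z - xs‖ ^ 2 / 2 + (‖x - z‖ ^ 2 / 4
        - (α' - a) * inner ℝ (∇ P.f₂ x - ∇ P.f₂ z) (x - z))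
      + a * (σ * (P.val₁ x - P.val₁ xs) + (P.val₂ x - P.val₂ xs)) ≤
    ‖x - xs‖ ^ 2 / 2 + q
      + a * ρ * (σ * (P.val₁ xp - P.val₁ x) + (P.val₂ xp - P.val₂ x)) := by
  have hxd := hx.mem_dom hP hσ
  have hzd := hz.mem_dom hP hσ'
  have hd := sub_nonneg.2 haα
  -- As `a σ = α' σ'`, the second step with weights `(σ', α')` splits into the old penalized problem
  -- with weight `a` and the lower level problem with weight `α' - a`. The surplus is handled by
  -- optimality of `xs` (`e4`) and convexity of `f₂` (`e5`). Testing the first step at `z` with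
  -- weight `ρ` (`e3`) matches the weight `a`.
  have e1 := hz.inner_le hP hσ' hα' (mem_dom_of_mem_X₁ hxs)
  have e2 := mul_le_mul_of_nonneg_left
    ((f_convex hP hσ'.le).add_inner_gradient_le (f_differentiable hP σ') x xs) hα'.le
  have e3 := mul_le_mul_of_nonneg_left (hx.inner_le hP hσ hα hzd) hρ
  have e4 := mul_le_mul_of_nonneg_left (val₂_le_of_mem_X₁ hP hxs hzd) hd
  have e5 := mul_le_mul_of_nonneg_left (hP.f₂_convex.add_inner_gradient_le
    (hP.f₂_contDiff.differentiable one_ne_zero) z x) hd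
  have e7 := mul_le_mul_of_nonneg_left (hx.sq_sub_inner_le hP hσ hα hxp) (sq_nonneg ρ)
  set D := ∇ (P.f σ) xp - ∇ (P.f σ) x with hD
  -- Young's inequality spends only half of the available `‖x - z‖² / 2`; the rest becomes the new
  -- displacement term. The square on the right is shared between the descent estimate `e7` and `q`.
  have e6 : ρ * inner ℝ (xp - x - α • D) (x - z) ≤ ‖x - z‖ ^ 2 / 4
      + ρ ^ 2 * ‖xp - x - α • D‖ ^ 2 := by
    have h1 := mul_le_mul_of_nonneg_left (real_inner_le_norm (xp - x - α • D) (x - z)) hρ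
    nlinarith [sq_nonneg (‖x - z‖ / 2 - ρ * ‖xp - x - α • D‖)]
  have n1 : ‖xp - x - α • D‖ ^ 2
      = ‖xp - x‖ ^ 2 - 2 * (α * inner ℝ D (xp - x)) + α ^ 2 * ‖D‖ ^ 2 := by
    rw [norm_sub_sq_real, inner_smul_right, norm_smul, Real.norm_of_nonneg hα.le, mul_pow,
      real_inner_comm]
  have n2 : inner ℝ (xp - x - α • D) (x - z) = inner ℝ (xp - x) (x - z)
      - α * inner ℝ (∇ (P.f σ) xp) (x - z) + α * inner ℝ (∇ (P.f σ) x) (x - z) := by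
    rw [hD, inner_sub_left, inner_smul_left, inner_sub_left (∇ (P.f σ) xp)]
    simp only [conj_trivial]
    ring
  have n3 : inner ℝ (x - α' • ∇ (P.f σ') x - z) (xs - z)
      = inner ℝ (x - z) (xs - z) - α' * inner ℝ (∇ (P.f σ') x) (xs - x)
        - α' * inner ℝ (∇ (P.f σ') x) (x - z) := by
    have h1 : xs - z = (xs - x) + (x - z) := by abel
    rw [sub_right_comm, inner_sub_left, inner_smul_left]
    conv_lhs => rw [h1, inner_add_right (∇ (P.f σ') x), ← h1]
    simp only [conj_trivial]
    ring
  have n4 : α' * inner ℝ (∇ (P.f σ') x) (x - z)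
      = a * inner ℝ (∇ (P.f σ) x) (x - z) + (α' - a) * inner ℝ (∇ P.f₂ x) (x - z) := by
    rw [gradient_f hP, gradient_f hP]
    simp only [inner_add_left, inner_smul_left, conj_trivial]
    linear_combination (-inner ℝ (∇ P.f₁ x) (x - z)) * haσ
  have n5 : inner ℝ (xp - α • ∇ (P.f σ) xp - x) (z - x)
      = -(inner ℝ (xp - x) (x - z) - α * inner ℝ (∇ (P.f σ) xp) (x - z)) := by
    rw [sub_right_comm, ← neg_sub x z, inner_neg_right, inner_sub_left, inner_smul_left]
    simp only [conj_trivial]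
  have n6 : ‖x - xs‖ ^ 2 = ‖x - z‖ ^ 2 - 2 * inner ℝ (x - z) (xs - z) + ‖z - xs‖ ^ 2 := by
    have : x - xs = (x - z) - (xs - z) := by abel
    rw [this, norm_sub_sq_real, norm_sub_rev xs z]
  have n7 : ∀ s t : ℝ, α' * (σ' * s + t) = a * (σ * s + t) + (α' - a) * t := by
    intro s t
    linear_combination (-s) * haσ
  have n8 : ∀ t : ℝ, ρ * (α * t) = a * t := by
    intro t
    rw [← mul_assoc, hρα]
  have n9 : ∀ t : ℝ, ρ ^ 2 * (α * t) = a * ρ * t := by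
    intro t
    rw [← hρα]
    ring
  rw [n3, n4, n7] at e1
  rw [n5, n8] at e3
  rw [n9] at e7
  rw [n2, n1] at e6
  have n10 : ρ * (inner ℝ (xp - x) (x - z) - α * inner ℝ (∇ (P.f σ) xp) (x - z)
      + α * inner ℝ (∇ (P.f σ) x) (x - z))
      = ρ * (inner ℝ (xp - x) (x - z) - α * inner ℝ (∇ (P.f σ) xp) (x - z))
        + a * inner ℝ (∇ (P.f σ) x) (x - z) := by
    rw [mul_add, n8]
  rw [n10] at e6
  have n11 : ∀ u, α' * P.f σ' u = a * P.f σ u + (α' - a) * P.f₂ u := fun u => n7 _ _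
  rw [mul_add, n11, n11] at e2
  rw [inner_sub_left (∇ P.f₂ x)]
  simp only [val₁, val₂, f] at *
  linarith

end BilevelProblem

theorem exists_seq_of_forall_exists {S : Type*} (I : ℕ → S → Prop) (r : ℕ → S → S → Prop)
    {s₀ : S} (h0 : I 0 s₀) (hs : ∀ k s, I k s → ∃ t, I (k + 1) t ∧ r k s t) :
    ∃ u : ℕ → S, u 0 = s₀ ∧ ∀ k, I k (u k) ∧ r k (u k) (u (k + 1)) := by
  choose! T hT using hs
  let u : ℕ → S := fun k => Nat.rec s₀ (fun k s => T k s) k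
  have hI : ∀ k, I k (u k) := by
    intro k
    induction k with
    | zero => exact h0
    | succ k ih => exact (hT k _ ih).1
  exact ⟨u, rfl, fun k => ⟨hI k, (hT k _ (hI k)).2⟩⟩

theorem IsPenaltySeq.prev_pos {σ : ℕ → ℝ} (h : IsPenaltySeq σ) (k : ℕ) :
    0 < prev (σ 0) σ k := by
  cases k with
  | zero => exact h.pos
  | succ k => exact h.pos' k

theorem IsPenaltySeq.mem_prev {σ : ℕ → ℝ} (h : IsPenaltySeq σ) (k : ℕ) :
    3 / 4 * prev (σ 0) σ k ≤ σ k ∧ σ k ≤ prev (σ 0) σ k := by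
  cases k with
  | zero =>
    have := h.pos
    exact ⟨by simp only [prev]; linarith, le_rfl⟩
  | succ k => exact h.mem k

/-! ### adaBiM: well-definedness and stepsizes. -/

namespace BilevelProblem

variable {n : ℕ} {P : BilevelProblem n}

/-- The linesearch of adaBiM terminates. -/
theorem exists_linesearch (hP : P.BasicAssumption) {σ η ν t : ℝ} (hσ : 0 < σ)
    (hη : η ∈ Set.Ioo (0 : ℝ) 1) (hν : 0 < ν) (ht : 0 < t) (x : EuclideanSpace ℝ (Fin n)) :
    ∃ a z, 0 < a ∧ P.IsProxGradStep σ a x z ∧ a * lipEst (P.f σ) x z ≤ ν ∧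
      IsGreatest {a : ℝ | (∃ i : ℕ, a = t * η ^ i) ∧
        ∃ z, P.IsProxGradStep σ a x z ∧ a * lipEst (P.f σ) x z ≤ ν} a := by
  have hpos : ∀ i : ℕ, 0 < t * η ^ i := fun i => mul_pos ht (pow_pos hη.1 i)
  have hex : ∃ i : ℕ, ∃ z, P.IsProxGradStep σ (t * η ^ i) x z ∧
      t * η ^ i * lipEst (P.f σ) x z ≤ ν := by
    -- For stepsizes up to `t` all trial points lie in one ball, with a common Lipschitz modulus
    -- `L`; every stepsize below `ν / L` passes the test.
    obtain ⟨R, hR⟩ := exists_isProxGradStep_bound hP σ t ‖x‖ hσ.le ht.le (norm_nonneg x)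
    obtain ⟨L, hL, hlip⟩ := exists_lipschitz_on_ball hP σ (max R ‖x‖) hσ.le
    obtain ⟨i, hi⟩ := exists_pow_lt_of_lt_one (by positivity : 0 < ν / (t * L)) hη.2
    obtain ⟨z, hz⟩ := exists_isProxGradStep hP hσ (hpos i) x
    have hit : t * η ^ i ≤ t := mul_le_of_le_one_right ht.le (pow_le_one₀ hη.1.le hη.2.le)
    have hzR := hR σ _ x z hσ le_rfl (hpos i) hit le_rfl hz
    have h1 := lipEst_le_of_lipschitz hL.le
      (hlip σ x z hσ le_rfl (le_max_right _ _) (hzR.trans (le_max_left _ _)))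
    refine ⟨i, z, hz, (mul_le_mul_of_nonneg_left h1 (hpos i).le).trans ?_⟩
    rw [lt_div_iff₀ (by positivity)] at hi
    linarith
  classical
  obtain ⟨z, hz, hz'⟩ := Nat.find_spec hex
  refine ⟨_, z, hpos _, hz, hz', ⟨⟨_, rfl⟩, z, hz, hz'⟩, ?_⟩
  rintro a ⟨⟨j, rfl⟩, hj⟩
  have := Nat.find_min' hex hj
  exact mul_le_mul_of_nonneg_left (pow_le_pow_of_le_one hη.1.le hη.2.le this) ht.le

section Adaptive

variable {η ν αmax αinit α₀ : ℝ} {σ : ℕ → ℝ} {xinit : EuclideanSpace ℝ (Fin n)}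
  {x : ℕ → EuclideanSpace ℝ (Fin n)} {α : ℕ → ℝ}

theorem exists_isAdaBiM (hP : P.BasicAssumption) (hσ : IsPenaltySeq σ)
    (hν : ν ∈ Set.Ioo (0 : ℝ) 1) (hη : η ∈ Set.Ioo (0 : ℝ) 1) (hmax : 0 < αmax)
    (hinit : 0 < αinit) (h₀ : 0 < α₀) (xinit : EuclideanSpace ℝ (Fin n)) :
    ∃ x α, P.IsAdaBiM η ν αmax σ xinit αinit α₀ x α := by
  obtain ⟨x₀, hx₀⟩ := exists_isProxGradStep hP (hσ.pos' 0) h₀ xinit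
  let E := EuclideanSpace ℝ (Fin n)
  -- The state holds two consecutive iterates and stepsizes; the invariant is what makes the next
  -- trial stepsize positive.
  obtain ⟨u, hu0, hu⟩ := exists_seq_of_forall_exists (S := (E × E) × (ℝ × ℝ))
    (fun k s => 0 < s.2.1 ∧ 0 < s.2.2 ∧
      (prev (σ 0) σ k = σ k ∨ s.2.2 * lipEst (P.f (σ k)) s.1.1 s.1.2 ≤ ν))
    (fun k s t => t.1.1 = s.1.2 ∧ t.2.1 = s.2.2 ∧
      IsGreatest {a : ℝ | (∃ i : ℕ, a = P.trialStepsize αmax (prev (σ 0) σ k) (σ k) (σ (k + 1))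
        s.2.1 s.2.2 s.1.1 s.1.2 * η ^ i) ∧
      ∃ z, P.IsProxGradStep (σ (k + 1)) a s.1.2 z ∧
        a * lipEst (P.f (σ (k + 1))) s.1.2 z ≤ ν} t.2.2 ∧
      P.IsProxGradStep (σ (k + 1)) t.2.2 s.1.2 t.1.2)
    (s₀ := ((xinit, x₀), (αinit, α₀))) ⟨hinit, h₀, Or.inl rfl⟩ (by
      rintro k ⟨⟨xp, x⟩, ⟨αp, α⟩⟩ ⟨h1, h2, h3⟩
      have hrad : 0 < P.radicand (prev (σ 0) σ k) (σ k) α xp x :=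
        lt_of_lt_of_le (sub_pos.2 hν.2) (one_sub_le_radicand hP (hσ.prev_pos k) (hσ.pos' k)
          (hσ.mem_prev k).1 (hσ.mem_prev k).2 h2.le hν.1.le h3)
      obtain ⟨a, z, ha, hz, hz', hg⟩ := exists_linesearch hP (hσ.pos' (k + 1)) hη hν.1
        (trialStepsize_pos (αmax := αmax) (hσ.prev_pos k) (hσ.pos' k) (hσ.pos' (k + 1)) h1 h2
          hmax hrad) x
      exact ⟨((x, z), (α, a)), ⟨h2, ha, Or.inr hz'⟩, rfl, rfl, hg, hz⟩)
  have hpx : ∀ k, prev xinit (fun k => (u k).1.2) k = (u k).1.1 := by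
    intro k
    cases k with
    | zero => rw [hu0]; rfl
    | succ k => exact (hu k).2.1.symm
  have hpα : ∀ k, prev αinit (fun k => (u k).2.2) k = (u k).2.1 := by
    intro k
    cases k with
    | zero => rw [hu0]; rfl
    | succ k => exact (hu k).2.2.1.symm
  refine ⟨fun k => (u k).1.2, fun k => (u k).2.2, ?_, ?_, fun k => ?_, fun k => (hu k).2.2.2.2⟩
  · rw [hu0]
  · simp only [hu0]
    exact hx₀
  · rw [hpx, hpα]
    exact (hu k).2.2.2.1

namespace IsAdaBiM

theorem mem_dom (h : P.IsAdaBiM η ν αmax σ xinit αinit α₀ x α) (hP : P.BasicAssumption)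
    (hσ : IsPenaltySeq σ)
    (k : ℕ) : x k ∈ P.dom := by
  cases k with
  | zero => exact h.x_zero.mem_dom hP (hσ.pos' 0)
  | succ k => exact (h.x_succ k).mem_dom hP (hσ.pos' _)

/-- Positivity of the stepsizes and validity of the linesearch test. -/
theorem basic (h : P.IsAdaBiM η ν αmax σ xinit αinit α₀ x α) (hP : P.BasicAssumption)
    (hσ : IsPenaltySeq σ) (hν : ν ∈ Set.Ioo (0 : ℝ) 1) (hη : η ∈ Set.Ioo (0 : ℝ) 1)
    (hmax : 0 < αmax) (hinit : 0 < αinit) (h₀ : αinit ≤ α₀)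
    (k : ℕ) : 0 < prev αinit α k ∧ 0 < α k ∧
    (prev (σ 0) σ k = σ k ∨ α k * lipEst (P.f (σ k)) (prev xinit x k) (x k) ≤ ν) := by
  induction k with
  | zero => exact ⟨hinit, by rw [h.α_zero]; linarith, Or.inl rfl⟩
  | succ k ih =>
    obtain ⟨h1, h2, h3⟩ := ih
    have hrad : 0 < P.radicand (prev (σ 0) σ k) (σ k) (α k) (prev xinit x k) (x k) :=
      lt_of_lt_of_le (sub_pos.2 hν.2) (one_sub_le_radicand hP (hσ.prev_pos k) (hσ.pos' k)
        (hσ.mem_prev k).1 (hσ.mem_prev k).2 h2.le hν.1.le h3)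
    have ht := trialStepsize_pos (αmax := αmax) (hσ.prev_pos k) (hσ.pos' k) (hσ.pos' (k + 1))
      h1 h2 hmax hrad
    obtain ⟨⟨i, hi⟩, z, hz, hz'⟩ := (h.α_succ k).1
    have hpos : 0 < α (k + 1) := by
      rw [hi]
      exact mul_pos ht (pow_pos hη.1 i)
    refine ⟨h2, hpos, Or.inr ?_⟩
    rw [(h.x_succ k).unique hP (hσ.pos' _) hpos hz]
    exact hz'

theorem α_pos (h : P.IsAdaBiM η ν αmax σ xinit αinit α₀ x α) (hP : P.BasicAssumption)
    (hσ : IsPenaltySeq σ) (hν : ν ∈ Set.Ioo (0 : ℝ) 1) (hη : η ∈ Set.Ioo (0 : ℝ) 1)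
    (hmax : 0 < αmax) (hinit : 0 < αinit) (h₀ : αinit ≤ α₀)
    (k : ℕ) : 0 < α k := (h.basic hP hσ hν hη hmax hinit h₀ k).2.1

theorem one_sub_le (h : P.IsAdaBiM η ν αmax σ xinit αinit α₀ x α) (hP : P.BasicAssumption)
    (hσ : IsPenaltySeq σ) (hν : ν ∈ Set.Ioo (0 : ℝ) 1) (hη : η ∈ Set.Ioo (0 : ℝ) 1)
    (hmax : 0 < αmax) (hinit : 0 < αinit) (h₀ : αinit ≤ α₀)
    (k : ℕ) :
    1 - ν ≤ P.radicand (prev (σ 0) σ k) (σ k) (α k) (prev xinit x k) (x k) :=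
  one_sub_le_radicand hP (hσ.prev_pos k) (hσ.pos' k) (hσ.mem_prev k).1 (hσ.mem_prev k).2
    (h.α_pos hP hσ hν hη hmax hinit h₀ k).le hν.1.le (h.basic hP hσ hν hη hmax hinit h₀ k).2.2

theorem test (h : P.IsAdaBiM η ν αmax σ xinit αinit α₀ x α) (hP : P.BasicAssumption)
    (hσ : IsPenaltySeq σ) (hν : ν ∈ Set.Ioo (0 : ℝ) 1) (hη : η ∈ Set.Ioo (0 : ℝ) 1)
    (hmax : 0 < αmax) (hinit : 0 < αinit) (h₀ : αinit ≤ α₀)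
    (k : ℕ) : α (k + 1) * inner ℝ (∇ (P.f (σ (k + 1))) (x k)
    - ∇ (P.f (σ (k + 1))) (x (k + 1))) (x k - x (k + 1)) ≤ ν * ‖x k - x (k + 1)‖ ^ 2 := by
  obtain ⟨-, z, hz, hz'⟩ := (h.α_succ k).1
  have h1 := (h.x_succ k).unique hP (hσ.pos' _) (h.α_pos hP hσ hν hη hmax hinit h₀ _) hz
  rw [← lipEst_mul_sq, ← mul_assoc]
  refine mul_le_mul_of_nonneg_right ?_ (by positivity)
  rw [h1]
  exact hz'

theorem α_succ_le (h : P.IsAdaBiM η ν αmax σ xinit αinit α₀ x α) (hP : P.BasicAssumption)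
    (hσ : IsPenaltySeq σ) (hν : ν ∈ Set.Ioo (0 : ℝ) 1) (hη : η ∈ Set.Ioo (0 : ℝ) 1)
    (hmax : 0 < αmax) (hinit : 0 < αinit) (h₀ : αinit ≤ α₀)
    (k : ℕ) : α (k + 1) ≤ P.trialStepsize αmax (prev (σ 0) σ k) (σ k) (σ (k + 1))
    (prev αinit α k) (α k) (prev xinit x k) (x k) := by
  obtain ⟨⟨i, hi⟩, -⟩ := (h.α_succ k).1
  obtain ⟨h1, h2, -⟩ := h.basic hP hσ hν hη hmax hinit h₀ k
  have ht := trialStepsize_pos (αmax := αmax) (hσ.prev_pos k) (hσ.pos' k) (hσ.pos' (k + 1))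
    h1 h2 hmax (lt_of_lt_of_le (sub_pos.2 hν.2) (h.one_sub_le hP hσ hν hη hmax hinit h₀ k))
  rw [hi]
  exact mul_le_of_le_one_right ht.le (pow_le_one₀ hη.1.le hη.2.le)

theorem α_succ_le_max (h : P.IsAdaBiM η ν αmax σ xinit αinit α₀ x α) (hP : P.BasicAssumption)
    (hσ : IsPenaltySeq σ) (hν : ν ∈ Set.Ioo (0 : ℝ) 1) (hη : η ∈ Set.Ioo (0 : ℝ) 1)
    (hmax : 0 < αmax) (hinit : 0 < αinit) (h₀ : αinit ≤ α₀)
    (k : ℕ) : α (k + 1) ≤ αmax :=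
  (h.α_succ_le hP hσ hν hη hmax hinit h₀ k).trans trialStepsize_le_max

theorem rho_succ_le (h : P.IsAdaBiM η ν αmax σ xinit αinit α₀ x α) (hP : P.BasicAssumption)
    (hσ : IsPenaltySeq σ) (hν : ν ∈ Set.Ioo (0 : ℝ) 1) (hη : η ∈ Set.Ioo (0 : ℝ) 1)
    (hmax : 0 < αmax) (hinit : 0 < αinit) (h₀ : αinit ≤ α₀)
    (k : ℕ) : σ (k + 1) * α (k + 1) / (σ k * α k) ≤
    √(σ k / prev (σ 0) σ k * (1 + σ k * α k / (prev (σ 0) σ k * prev αinit α k))) :=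
  ratio_le_of_le_trialStepsize (hσ.pos' k) (hσ.pos' (k + 1))
    (h.α_pos hP hσ hν hη hmax hinit h₀ k) (h.α_succ_le hP hσ hν hη hmax hinit h₀ k)

/-- The growth bound gives `ρ_{k+1} ≤ √(1 + ρ_k)`, and `1 + R ≤ R²` for `R ≥ 2`. The bound fixes the
weight of the gap in the energy. -/
theorem rho_le (h : P.IsAdaBiM η ν αmax σ xinit αinit α₀ x α) (hP : P.BasicAssumption)
    (hσ : IsPenaltySeq σ) (hν : ν ∈ Set.Ioo (0 : ℝ) 1) (hη : η ∈ Set.Ioo (0 : ℝ) 1)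
    (hmax : 0 < αmax) (hinit : 0 < αinit) (h₀ : αinit ≤ α₀)
    (k : ℕ) :
    σ k * α k / (prev (σ 0) σ k * prev αinit α k) ≤ max 2 (α₀ / αinit) := by
  induction k with
  | zero =>
    refine le_trans (le_of_eq ?_) (le_max_right _ _)
    simp only [prev, h.α_zero]
    have := hσ.pos
    field_simp
  | succ k ih =>
    set R := max 2 (α₀ / αinit) with hR
    have hR2 : 2 ≤ R := le_max_left _ _
    refine (h.rho_succ_le hP hσ hν hη hmax hinit h₀ k).trans ?_
    rw [Real.sqrt_le_left (by linarith)]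
    obtain ⟨h1, h2, -⟩ := h.basic hP hσ hν hη hmax hinit h₀ k
    have h3 := hσ.prev_pos k
    have h4 := hσ.pos' k
    have h5 : σ k / prev (σ 0) σ k ≤ 1 := (div_le_one h3).2 (hσ.mem_prev k).2
    have h6 : 0 ≤ 1 + σ k * α k / (prev (σ 0) σ k * prev αinit α k) := by positivity
    have h7 := mul_le_mul_of_nonneg_right h5 h6
    nlinarith

/-- Either bound on the next stepsize: an absolute one, or the growth bound. -/
theorem exists_min_le_α_succ (h : P.IsAdaBiM η ν αmax σ xinit αinit α₀ x α) (hP : P.BasicAssumption)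
    (hσ : IsPenaltySeq σ) (hν : ν ∈ Set.Ioo (0 : ℝ) 1) (hη : η ∈ Set.Ioo (0 : ℝ) 1)
    (hmax : 0 < αmax) (hinit : 0 < αinit) (h₀ : αinit ≤ α₀)
    {K : ℝ} (hK : ∀ k, ‖x k‖ ≤ K) : ∃ c : ℝ, 0 < c ∧ ∀ k,
    min c (√(σ k / prev (σ 0) σ k * (1 + σ k * α k / (prev (σ 0) σ k * prev αinit α k))) * α k)
      ≤ α (k + 1) := by
  obtain ⟨R, hR⟩ := exists_isProxGradStep_bound hP (σ 0) αmax K hσ.pos.le hmax.le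
    ((norm_nonneg _).trans (hK 0))
  obtain ⟨L, hL, hlip⟩ := exists_lipschitz_on_ball hP (σ 0) (max R (max K ‖xinit‖)) hσ.pos.le
  have hxK : ∀ k, ‖x k‖ ≤ max R (max K ‖xinit‖) := fun k =>
    (hK k).trans ((le_max_left _ _).trans (le_max_right _ _))
  have hpK : ∀ k, ‖prev xinit x k‖ ≤ max R (max K ‖xinit‖) := by
    intro k
    cases k with
    | zero => exact (le_max_right _ _).trans (le_max_right _ _)
    | succ k => exact hxK k
  have hν1 : 0 < 1 - ν := sub_pos.2 hν.2
  have hs := Real.sqrt_pos.2 hν1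
  have hη0 := hη.1
  have hν0 := hν.1
  -- The first two constants serve an accepted trial stepsize. The last serves a reduced one: `α (k
  -- + 1) / η` was then rejected, hence exceeds `ν / L`.
  refine ⟨min (min (√(1 - ν) / (2 * L)) αmax) (η * (ν / L)), by positivity, fun k => ?_⟩
  set g := √(σ k / prev (σ 0) σ k * (1 + σ k * α k / (prev (σ 0) σ k * prev αinit α k))) * α k
    with hg
  have htr := min_le_trialStepsize (αmax := αmax) (σp := prev (σ 0) σ k)
    (αp := prev αinit α k) hP (hσ.pos' k) (hσ.pos' (k + 1)) (hσ.succ_le k)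
    (h.α_pos hP hσ hν hη hmax hinit h₀ k) hL (h.one_sub_le hP hσ hν hη hmax hinit h₀ k)
    (hlip (σ k) _ _ (hσ.pos' k) (hσ.le_zero k) (hpK k) (hxK k))
  rw [← hg] at htr
  have htle : P.trialStepsize αmax (prev (σ 0) σ k) (σ k) (σ (k + 1))
    (prev αinit α k) (α k) (prev xinit x k) (x k) ≤ αmax := trialStepsize_le_max
  obtain ⟨⟨⟨i, hi⟩, -⟩, hub⟩ := h.α_succ k
  have hαpos := h.α_pos hP hσ hν hη hmax hinit h₀ (k + 1)
  set t := P.trialStepsize αmax (prev (σ 0) σ k) (σ k) (σ (k + 1))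
    (prev αinit α k) (α k) (prev xinit x k) (x k) with ht
  cases i with
  | zero =>
    rw [hi, pow_zero, mul_one]
    refine le_trans ?_ htr
    exact min_le_min_right _ (min_le_left _ _)
  | succ i =>
    refine (min_le_left _ _).trans ((min_le_right _ _).trans ?_)
    have hprod : α (k + 1) = η * (t * η ^ i) := by
      rw [hi]
      ring
    have ha : 0 < t * η ^ i := by
      rw [hprod] at hαpos
      exact pos_of_mul_pos_right hαpos hη0.le
    have ht0 : 0 < t := pos_of_mul_pos_left ha (pow_pos hη0 i).le
    have hat : t * η ^ i ≤ αmax :=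
      (mul_le_of_le_one_right ht0.le (pow_le_one₀ hη0.le hη.2.le)).trans htle
    obtain ⟨z, hz⟩ := exists_isProxGradStep hP (hσ.pos' (k + 1)) ha (x k)
    have hfail : ν < t * η ^ i * lipEst (P.f (σ (k + 1))) (x k) z := by
      by_contra! hcon
      have h1 : t * η ^ i ≤ α (k + 1) := hub ⟨⟨i, rfl⟩, z, hz, hcon⟩
      rw [hprod] at h1
      nlinarith [mul_lt_mul_of_pos_right hη.2 ha]
    have hzR := hR _ _ _ _ (hσ.pos' (k + 1)) (hσ.le_zero _) ha hat (hK k) hz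
    have hle := lipEst_le_of_lipschitz hL.le (hlip _ (x k) z (hσ.pos' (k + 1)) (hσ.le_zero _)
      (hxK k) (hzR.trans (le_max_left _ _)))
    rw [hprod]
    refine mul_le_mul_of_nonneg_left ?_ hη0.le
    rw [div_le_iff₀ hL]
    exact hfail.le.trans (mul_le_mul_of_nonneg_left hle ha.le)

/-- Along bounded iterates the stepsizes are bounded away from zero. -/
theorem exists_le_α (h : P.IsAdaBiM η ν αmax σ xinit αinit α₀ x α) (hP : P.BasicAssumption)
    (hσ : IsPenaltySeq σ) (hν : ν ∈ Set.Ioo (0 : ℝ) 1) (hη : η ∈ Set.Ioo (0 : ℝ) 1)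
    (hmax : 0 < αmax) (hinit : 0 < αinit) (h₀ : αinit ≤ α₀)
    {K : ℝ} (hK : ∀ k, ‖x k‖ ≤ K) : ∃ c : ℝ, 0 < c ∧ ∀ k, c ≤ α k := by
  obtain ⟨c, hc, hmin⟩ := h.exists_min_le_α_succ hP hσ hν hη hmax hinit h₀ hK
  have hbasic := h.basic hP hσ hν hη hmax hinit h₀
  set r := fun k => σ k / prev (σ 0) σ k with hr
  set ρ := fun k => σ k * α k / (prev (σ 0) σ k * prev αinit α k) with hρ
  have hr1 : ∀ k, 3 / 4 ≤ r k := fun k => by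
    simp only [hr]
    rw [le_div_iff₀ (hσ.prev_pos k)]
    exact (hσ.mem_prev k).1
  have hρ0 : ∀ k, 0 < ρ k := fun k =>
    div_pos (mul_pos (hσ.pos' k) (hbasic k).2.1) (mul_pos (hσ.prev_pos k) (hbasic k).1)
  have hg1 : ∀ k, 3 / 4 ≤ √(r k * (1 + ρ k)) := fun k => by
    refine Real.le_sqrt_of_sq_le ?_
    nlinarith [hr1 k, hρ0 k, mul_pos (lt_of_lt_of_le (by norm_num) (hr1 k)) (hρ0 k)]
  have hg2 : ∀ k, 1 / 3 ≤ ρ k → 1 ≤ √(r k * (1 + ρ k)) := fun k hk => by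
    refine Real.le_sqrt_of_sq_le ?_
    nlinarith [hr1 k]
  have hαpos := fun k => (hbasic k).2.1
  -- If `ρ k ≥ 1/3`, the growth factor is at least 1, since `3/4 · 4/3 = 1`. If `ρ k < 1/3`, the
  -- growth bound was not attained one step earlier, as it would give `ρ k ≥ 9/16`. So `α k ≥ c`,
  -- and one more step loses at most the factor `3/4`. At `k = 0` the second case is excluded by
  -- `αinit ≤ α₀`.
  refine ⟨min (α 0) (3 / 4 * c), lt_min (hαpos 0) (by positivity), fun k => ?_⟩
  have hm2 : min (α 0) (3 / 4 * c) ≤ 3 / 4 * c := min_le_right _ _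
  induction k with
  | zero => exact min_le_left _ _
  | succ k ih =>
    rcases le_or_gt (1 / 3) (ρ k) with hk | hk
    · refine le_trans (le_min (by linarith) ?_) (hmin k)
      have := mul_le_mul_of_nonneg_right (hg2 k hk) (hαpos k).le
      linarith
    · have hck : c ≤ α k := by
        cases k with
        | zero =>
          exfalso
          have h1 : ρ 0 = α 0 / αinit := by
            simp only [hρ, prev]
            have := hσ.pos
            field_simp
          rw [h1, h.α_zero, div_lt_iff₀ hinit] at hk
          linarith
        | succ k =>
          have h1 := hmin k
          rcases min_le_iff.1 h1 with h2 | h2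
          · exact h2
          · exfalso
            have h3 := mul_le_mul_of_nonneg_right (hg1 k) (hαpos k).le
            have h4 : ρ (k + 1) = r (k + 1) * α (k + 1) / α k := by
              simp only [hρ, hr, prev]
              have := hσ.pos' k
              have := hαpos k
              field_simp
            rw [h4, div_lt_iff₀ (hαpos k)] at hk
            have h5 := mul_le_mul_of_nonneg_right (hr1 (k + 1)) (hαpos (k + 1)).le
            have h6 := hαpos k
            have h7 : 3 / 4 * α k ≤ α (k + 1) := h3.trans h2
            linarith
      refine le_trans (le_min (by linarith) ?_) (hmin k)
      have := mul_le_mul_of_nonneg_right (hg1 k) (hαpos k).le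
      linarith

end IsAdaBiM

end Adaptive

end BilevelProblem

/-! ### adaBiM: energy and convergence. -/

namespace BilevelProblem

variable {n : ℕ} {P : BilevelProblem n} {η ν αmax αinit α₀ : ℝ} {σ : ℕ → ℝ}
  {xinit : EuclideanSpace ℝ (Fin n)} {x : ℕ → EuclideanSpace ℝ (Fin n)} {α : ℕ → ℝ}

/-- The penalized optimality gap, shifted to be nonnegative. -/
noncomputable def gap (P : BilevelProblem n) (m : ℝ) (xs : EuclideanSpace ℝ (Fin n)) (σ : ℝ)
    (y : EuclideanSpace ℝ (Fin n)) : ℝ :=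
  σ * (P.val₁ y - m) + (P.val₂ y - P.val₂ xs)

/-- The part of the energy of adaBiM that depends on the last displacement. -/
noncomputable def displacementEnergy (P : BilevelProblem n) (σp σ α : ℝ)
    (xp x : EuclideanSpace ℝ (Fin n)) : ℝ :=
  ‖xp - x‖ ^ 2 / 4 - (α - α * σ / σp) * inner ℝ (∇ P.f₂ xp - ∇ P.f₂ x) (xp - x)

/-- This explains the numerator of the second stepsize bound: that bound says `ρ² · excess ≤
radicand / 4`, so the error of the next step is covered by this energy. -/
theorem displacementEnergy_eq {σp σ α : ℝ} {xp x : EuclideanSpace ℝ (Fin n)} :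
    P.displacementEnergy σp σ α xp x = P.radicand σp σ α xp x / 4 * ‖xp - x‖ ^ 2 := by
  rw [displacementEnergy, radicand, ← lipEst_mul_sq]
  ring

theorem gap_nonneg (hP : P.BasicAssumption) {m s : ℝ} (hm : ∀ x ∈ P.dom, m ≤ P.val₁ x)
    {xs y : EuclideanSpace ℝ (Fin n)} (hxs : xs ∈ P.X₁) (hy : y ∈ P.dom) (hs : 0 ≤ s) :
    0 ≤ P.gap m xs s y :=
  add_nonneg (mul_nonneg hs (sub_nonneg.2 (hm _ hy))) (sub_nonneg.2 (val₂_le_of_mem_X₁ hP hxs hy))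

namespace IsAdaBiM

theorem displacementEnergy_nonneg (h : P.IsAdaBiM η ν αmax σ xinit αinit α₀ x α)
    (hP : P.BasicAssumption)
    (hσ : IsPenaltySeq σ) (hν : ν ∈ Set.Ioo (0 : ℝ) 1) (hη : η ∈ Set.Ioo (0 : ℝ) 1)
    (hmax : 0 < αmax) (hinit : 0 < αinit) (h₀ : αinit ≤ α₀)
    (k : ℕ) :
    0 ≤ P.displacementEnergy (σ k) (σ (k + 1)) (α (k + 1)) (x k) (x (k + 1)) := by
  have h1 : 1 - ν ≤ P.radicand (σ k) (σ (k + 1)) (α (k + 1)) (x k) (x (k + 1)) :=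
    h.one_sub_le hP hσ hν hη hmax hinit h₀ (k + 1)
  have h2 := hν.2
  rw [displacementEnergy_eq]
  exact mul_nonneg (by linarith) (by positivity)

theorem displacementEnergy_le (h : P.IsAdaBiM η ν αmax σ xinit αinit α₀ x α)
    (hP : P.BasicAssumption)
    (hσ : IsPenaltySeq σ) (hν : ν ∈ Set.Ioo (0 : ℝ) 1) (hη : η ∈ Set.Ioo (0 : ℝ) 1)
    (hmax : 0 < αmax) (hinit : 0 < αinit) (h₀ : αinit ≤ α₀)
    (k : ℕ) :
    P.displacementEnergy (σ k) (σ (k + 1)) (α (k + 1)) (x k) (x (k + 1))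
      ≤ ‖x k - x (k + 1)‖ ^ 2 / 4 := by
  rw [displacementEnergy]
  have h1 := hP.f₂_convex.inner_gradient_sub_nonneg
    (hP.f₂_contDiff.differentiable one_ne_zero) (x k) (x (k + 1))
  have h2 : α (k + 1) * σ (k + 1) / σ k ≤ α (k + 1) := by
    rw [div_le_iff₀ (hσ.pos' k)]
    exact mul_le_mul_of_nonneg_left (hσ.succ_le k) (h.α_pos hP hσ hν hη hmax hinit h₀ _).le
  have h3 := mul_nonneg (sub_nonneg.2 h2) h1
  linarith

/-- The bracket of the decrease inequality is nonnegative and bounded by the decrease of the gap. -/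
theorem decrease_bounds (h : P.IsAdaBiM η ν αmax σ xinit αinit α₀ x α) (hP : P.BasicAssumption)
    (hσ : IsPenaltySeq σ) (hν : ν ∈ Set.Ioo (0 : ℝ) 1) (hη : η ∈ Set.Ioo (0 : ℝ) 1)
    (hmax : 0 < αmax) (hinit : 0 < αinit) (h₀ : αinit ≤ α₀)
    {m : ℝ} (hm : ∀ x ∈ P.dom, m ≤ P.val₁ x)
    (xs : EuclideanSpace ℝ (Fin n)) (k : ℕ) :
    (1 - ν) * ‖x k - x (k + 1)‖ ^ 2 ≤ α (k + 1) *
      (σ (k + 1) * (P.val₁ (x k) - P.val₁ (x (k + 1))) + (P.val₂ (x k) - P.val₂ (x (k + 1)))) ∧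
    0 ≤ σ (k + 1) * (P.val₁ (x k) - P.val₁ (x (k + 1))) + (P.val₂ (x k) - P.val₂ (x (k + 1))) ∧
    σ (k + 1) * (P.val₁ (x k) - P.val₁ (x (k + 1))) + (P.val₂ (x k) - P.val₂ (x (k + 1)))
      ≤ P.gap m xs (σ k) (x k) - P.gap m xs (σ (k + 1)) (x (k + 1)) := by
  have hd := h.mem_dom hP hσ
  have hα := h.α_pos hP hσ hν hη hmax hinit h₀ (k + 1)
  have h1 := (h.x_succ k).sq_sub_inner_le hP (hσ.pos' _) hα (hd k)
  have h2 := h.test hP hσ hν hη hmax hinit h₀ k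
  have h3 : (1 - ν) * ‖x k - x (k + 1)‖ ^ 2 ≤ α (k + 1) *
      (σ (k + 1) * (P.val₁ (x k) - P.val₁ (x (k + 1)))
        + (P.val₂ (x k) - P.val₂ (x (k + 1)))) := by linarith
  have h4 : 0 ≤ (1 - ν) * ‖x k - x (k + 1)‖ ^ 2 :=
    mul_nonneg (sub_nonneg.2 hν.2.le) (by positivity)
  refine ⟨h3, nonneg_of_mul_nonneg_right (h4.trans h3) hα, ?_⟩
  have h5 := mul_le_mul_of_nonneg_right (hσ.succ_le k) (sub_nonneg.2 (hm _ (hd k)))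
  simp only [gap]
  linarith

theorem gap_antitone (h : P.IsAdaBiM η ν αmax σ xinit αinit α₀ x α) (hP : P.BasicAssumption)
    (hσ : IsPenaltySeq σ) (hν : ν ∈ Set.Ioo (0 : ℝ) 1) (hη : η ∈ Set.Ioo (0 : ℝ) 1)
    (hmax : 0 < αmax) (hinit : 0 < αinit) (h₀ : αinit ≤ α₀)
    {m : ℝ} (hm : ∀ x ∈ P.dom, m ≤ P.val₁ x)
    (xs : EuclideanSpace ℝ (Fin n)) : Antitone fun k => P.gap m xs (σ k) (x k) :=
  antitone_nat_of_succ_le fun k => by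
    obtain ⟨-, h1, h2⟩ := h.decrease_bounds hP hσ hν hη hmax hinit h₀ hm xs k
    linarith

/-- The descent of a step is at most the drop of the gap; vanishing gaps therefore yield vanishing
displacements. -/
theorem sq_le_gap (h : P.IsAdaBiM η ν αmax σ xinit αinit α₀ x α) (hP : P.BasicAssumption)
    (hσ : IsPenaltySeq σ) (hν : ν ∈ Set.Ioo (0 : ℝ) 1) (hη : η ∈ Set.Ioo (0 : ℝ) 1)
    (hmax : 0 < αmax) (hinit : 0 < αinit) (h₀ : αinit ≤ α₀)
    {m : ℝ} (hm : ∀ x ∈ P.dom, m ≤ P.val₁ x) {xs : EuclideanSpace ℝ (Fin n)}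
    (hxs : xs ∈ P.X₁) (k : ℕ) :
    ‖x k - x (k + 1)‖ ^ 2 ≤ αmax / (1 - ν) * P.gap m xs (σ k) (x k) := by
  obtain ⟨h1, h2, h3⟩ := h.decrease_bounds hP hσ hν hη hmax hinit h₀ hm xs k
  have hd := h.mem_dom hP hσ
  have h4 := gap_nonneg hP hm hxs (hd (k + 1)) (hσ.pos' (k + 1)).le
  have h5 := mul_le_mul_of_nonneg_right (h.α_succ_le_max hP hσ hν hη hmax hinit h₀ k) h2
  have h6 : (1 - ν) * ‖x k - x (k + 1)‖ ^ 2 ≤ αmax * P.gap m xs (σ k) (x k) :=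
    h1.trans (h5.trans (mul_le_mul_of_nonneg_left (by linarith) hmax.le))
  rw [div_mul_eq_mul_div, le_div_iff₀ (sub_pos.2 hν.2)]
  linarith

/-- The two-step inequality is used with `q` the previous displacement energy. The leftover `a ρ`
times the descent telescopes: `a ρ ≤ αmax * max 2 (α₀ / αinit)`, and the descent is at most the drop
of the gap. -/
theorem energy_le (h : P.IsAdaBiM η ν αmax σ xinit αinit α₀ x α) (hP : P.BasicAssumption)
    (hσ : IsPenaltySeq σ) (hν : ν ∈ Set.Ioo (0 : ℝ) 1) (hη : η ∈ Set.Ioo (0 : ℝ) 1)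
    (hmax : 0 < αmax) (hinit : 0 < αinit) (h₀ : αinit ≤ α₀)
    {m : ℝ} (hm : ∀ x ∈ P.dom, m ≤ P.val₁ x) {xs ws : EuclideanSpace ℝ (Fin n)}
    (hws : ws ∈ P.X₁) (k : ℕ) :
    ‖x (k + 2) - ws‖ ^ 2 / 2
      + P.displacementEnergy (σ (k + 1)) (σ (k + 2)) (α (k + 2)) (x (k + 1)) (x (k + 2))
      + αmax * max 2 (α₀ / αinit) * P.gap m xs (σ (k + 1)) (x (k + 1)) ≤
    ‖x (k + 1) - ws‖ ^ 2 / 2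
      + P.displacementEnergy (σ k) (σ (k + 1)) (α (k + 1)) (x k) (x (k + 1))
      + αmax * max 2 (α₀ / αinit) * P.gap m xs (σ k) (x k)
      - α (k + 2) * σ (k + 2) / σ (k + 1) * (σ (k + 1) * (P.val₁ (x (k + 1)) - P.val₁ ws)
        + (P.val₂ (x (k + 1)) - P.val₂ ws)) := by
  have hpos := hσ.pos'
  have hα := h.α_pos hP hσ hν hη hmax hinit h₀
  have hd := h.mem_dom hP hσ
  have hs1 := hpos (k + 1)
  have hs2 := hpos (k + 2)
  have ha1 := hα (k + 1)
  have ha2 := hα (k + 2)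
  set a := α (k + 2) * σ (k + 2) / σ (k + 1) with ha
  set ρ := σ (k + 2) * α (k + 2) / (σ (k + 1) * α (k + 1)) with hρ
  have haα : a ≤ α (k + 2) := by
    rw [ha, div_le_iff₀ hs1]
    exact mul_le_mul_of_nonneg_left (hσ.succ_le (k + 1)) ha2.le
  have ha0 : 0 < a := by positivity
  have hρ0 : 0 < ρ := by positivity
  have hρα : ρ * α (k + 1) = a := by
    rw [ha, hρ]
    field_simp
  have hrad : 0 ≤ P.radicand (σ k) (σ (k + 1)) (α (k + 1)) (x k) (x (k + 1)) := by
    have h1 : 1 - ν ≤ P.radicand (σ k) (σ (k + 1)) (α (k + 1)) (x k) (x (k + 1)) :=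
      h.one_sub_le hP hσ hν hη hmax hinit h₀ (k + 1)
    have h2 := hν.2
    linarith
  have hcv := f_convex hP hs1.le
  have hdf := f_differentiable hP (σ (k + 1))
  have hq : ρ ^ 2 * (α (k + 1) ^ 2 * ‖∇ (P.f (σ (k + 1))) (x k)
        - ∇ (P.f (σ (k + 1))) (x (k + 1))‖ ^ 2
      - α (k + 1) * inner ℝ (∇ (P.f (σ (k + 1))) (x k) - ∇ (P.f (σ (k + 1))) (x (k + 1)))
        (x k - x (k + 1)))
      ≤ P.displacementEnergy (σ k) (σ (k + 1)) (α (k + 1)) (x k) (x (k + 1)) := by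
    have h1 := mul_le_mul_of_nonneg_left
      (le_excess_mul_sq (u := x k) (v := x (k + 1)) hcv hdf ha1.le) (sq_nonneg ρ)
    have h2 : ρ ^ 2 * excess (P.f (σ (k + 1))) (α (k + 1)) (x k) (x (k + 1))
        ≤ P.radicand (σ k) (σ (k + 1)) (α (k + 1)) (x k) (x (k + 1)) / 4 :=
      sq_mul_excess_le hs1 hs2 ha1 hrad (excess_nonneg hcv hdf ha1.le) ha2.le
        (h.α_succ_le hP hσ hν hη hmax hinit h₀ (k + 1))
    have h3 := mul_le_mul_of_nonneg_right h2 (sq_nonneg ‖x k - x (k + 1)‖)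
    rw [displacementEnergy_eq]
    linarith
  have key := IsProxGradStep.energy_le hP hs1 hs2 ha1 ha2
    (by rw [ha]; field_simp) haα hρα hρ0.le (hd k) (h.x_succ k) (h.x_succ (k + 1)) hws hq
  obtain ⟨-, h2, h3⟩ := h.decrease_bounds hP hσ hν hη hmax hinit h₀ hm xs k
  have hρR : ρ ≤ max 2 (α₀ / αinit) := h.rho_le hP hσ hν hη hmax hinit h₀ (k + 2)
  have hamax : a ≤ αmax := haα.trans (h.α_succ_le_max hP hσ hν hη hmax hinit h₀ (k + 1))
  have h4 : a * ρ ≤ αmax * max 2 (α₀ / αinit) := mul_le_mul hamax hρR hρ0.le hmax.le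
  have h5 := mul_le_mul h4 h3 h2 (by positivity)
  have h6 : P.displacementEnergy (σ (k + 1)) (σ (k + 2)) (α (k + 2)) (x (k + 1)) (x (k + 2))
      = ‖x (k + 1) - x (k + 2)‖ ^ 2 / 4 - (α (k + 2) - a)
        * inner ℝ (∇ P.f₂ (x (k + 1)) - ∇ P.f₂ (x (k + 2))) (x (k + 1) - x (k + 2)) := rfl
  rw [h6]
  linarith

/-- Indices start at 1 because the two-step inequality needs its first point in `dom`, which may
fail for `xinit`. The error `ω` pays for passing from `x (k + 2)` to `y k = x (k + 1)` and for the
two extra energy terms. -/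
theorem energyDecrease (h : P.IsAdaBiM η ν αmax σ xinit αinit α₀ x α) (hP : P.BasicAssumption)
    (hσ : IsPenaltySeq σ) (hν : ν ∈ Set.Ioo (0 : ℝ) 1) (hη : η ∈ Set.Ioo (0 : ℝ) 1)
    (hmax : 0 < αmax) (hinit : 0 < αinit) (h₀ : αinit ≤ α₀)
    {m : ℝ} (hm : ∀ x ∈ P.dom, m ≤ P.val₁ x)
    {xs : EuclideanSpace ℝ (Fin n)} (hxs : xs ∈ P.X₁) :
    P.EnergyDecrease (fun k => σ (k + 1)) (fun k => α (k + 2) * σ (k + 2) / σ (k + 1))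
      (fun k => ‖x (k + 1) - x (k + 2)‖ + ‖x (k + 1) - x (k + 2)‖ ^ 2 / 4
        + αmax * max 2 (α₀ / αinit) * P.gap m xs (σ (k + 1)) (x (k + 1)))
      (fun k => x (k + 1)) (fun k => x (k + 1))
      (fun k w => ‖x (k + 1) - w‖ ^ 2 / 2
        + P.displacementEnergy (σ k) (σ (k + 1)) (α (k + 1)) (x k) (x (k + 1))
        + αmax * max 2 (α₀ / αinit) * P.gap m xs (σ k) (x k)) := by
  have hpos := hσ.pos'
  have hα := h.α_pos hP hσ hν hη hmax hinit h₀
  have hd := h.mem_dom hP hσ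
  have hgap : ∀ k, 0 ≤ αmax * max 2 (α₀ / αinit) * P.gap m xs (σ k) (x k) := fun k =>
    mul_nonneg (by positivity) (gap_nonneg hP hm hxs (hd k) (hpos k).le)
  refine ⟨fun k => (hpos _).le, fun k => ?_, fun k => ?_, fun k => hd _, fun k ws hws => ?_,
    fun k ws hws => ?_, fun k ws hws => ?_⟩
  · exact div_nonneg (mul_nonneg (hα _).le (hpos _).le) (hpos _).le
  · have := hgap (k + 1)
    positivity
  · exact h.energy_le hP hσ hν hη hmax hinit h₀ hm hws k
  · have h1 := h.displacementEnergy_nonneg hP hσ hν hη hmax hinit h₀ k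
    have h2 := hgap k
    linarith
  · have h1 := h.displacementEnergy_le hP hσ hν hη hmax hinit h₀ (k + 1)
    have h2 := hgap (k + 1)
    set d := ‖x (k + 1) - x (k + 2)‖ with hdd
    have h3 : ‖x (k + 2) - ws‖ ≤ ‖x (k + 1) - ws‖ + d := by
      have h4 := norm_sub_le (x (k + 1) - ws) (x (k + 1) - x (k + 2))
      have h5 : x (k + 1) - ws - (x (k + 1) - x (k + 2)) = x (k + 2) - ws := by abel
      rwa [h5] at h4
    have hd0 : 0 ≤ d := norm_nonneg _
    have h6 : ‖x (k + 2) - ws‖ ^ 2 ≤ (‖x (k + 1) - ws‖ + (d + d ^ 2 / 4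
        + αmax * max 2 (α₀ / αinit) * P.gap m xs (σ (k + 1)) (x (k + 1)))) ^ 2 := by
      have h7 : 0 ≤ d ^ 2 / 4 := by positivity
      exact pow_le_pow_left₀ (norm_nonneg _) (by linarith) 2
    have h8 : P.displacementEnergy (σ (k + 1)) (σ (k + 1 + 1)) (α (k + 1 + 1)) (x (k + 1))
      (x (k + 1 + 1)) ≤ d ^ 2 / 4 := h1
    have h9 : ‖x (k + 1 + 1) - ws‖ ^ 2 = ‖x (k + 2) - ws‖ ^ 2 := rfl
    rw [h9]
    linarith

/-- No lower bound on the stepsizes is needed here; such a bound relies on Lipschitz moduli that are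
uniform only once the iterates are bounded. -/
theorem exists_norm_le (h : P.IsAdaBiM η ν αmax σ xinit αinit α₀ x α) (hP : P.BasicAssumption)
    (hσ : IsPenaltySeq σ) (hν : ν ∈ Set.Ioo (0 : ℝ) 1) (hη : η ∈ Set.Ioo (0 : ℝ) 1)
    (hmax : 0 < αmax) (hinit : 0 < αinit) (h₀ : αinit ≤ α₀)
    : ∃ K : ℝ, ∀ k, ‖x k‖ ≤ K := by
  obtain ⟨xs, hxs⟩ := hP.X₁_nonempty
  obtain ⟨m, hm⟩ := exists_le_val₁ hP
  have hen := h.energyDecrease hP hσ hν hη hmax hinit h₀ hm hxs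
  have hd := h.mem_dom hP hσ
  have hanti := h.gap_antitone hP hσ hν hη hmax hinit h₀ hm xs
  set G := P.gap m xs (σ 0) (x 0) with hG
  have hGk : ∀ k, P.gap m xs (σ k) (x k) ≤ G := fun k => hanti (Nat.zero_le k)
  set B := αmax / (1 - ν) * G with hB
  have hsq : ∀ k, ‖x k - x (k + 1)‖ ^ 2 ≤ B := fun k =>
    (h.sq_le_gap hP hσ hν hη hmax hinit h₀ hm hxs k).trans
      (mul_le_mul_of_nonneg_left (hGk k) (div_nonneg hmax.le (sub_nonneg.2 hν.2.le)))
  obtain ⟨R, hR⟩ := hen.exists_bound hP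
    (Ω := (B + 1) + B / 4 + αmax * max 2 (α₀ / αinit) * G) (V := G + P.val₂ xs) (fun k => by
      have h1 := hsq (k + 1)
      have h2 : ‖x (k + 1) - x (k + 2)‖ ≤ B + 1 := by
        nlinarith [sq_nonneg (‖x (k + 1) - x (k + 1 + 1)‖ - 1)]
      have h3 := mul_le_mul_of_nonneg_left (hGk (k + 1))
        (by positivity : 0 ≤ αmax * max 2 (α₀ / αinit))
      have h4 : ‖x (k + 1) - x (k + 2)‖ ^ 2 / 4 ≤ B / 4 := by
        linarith
      linarith) (fun k => by
      have h1 := hGk (k + 1)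
      have h2 := mul_nonneg (hσ.pos' (k + 1)).le (sub_nonneg.2 (hm _ (hd (k + 1))))
      simp only [gap] at h1
      linarith)
  refine ⟨max R ‖x 0‖, fun k => ?_⟩
  cases k with
  | zero => exact le_max_right _ _
  | succ k => exact (hR k).trans (le_max_left _ _)

theorem convergesToSolutions (h : P.IsAdaBiM η ν αmax σ xinit αinit α₀ x α) (hP : P.BasicAssumption)
    (hσ : IsPenaltySeq σ) (hν : ν ∈ Set.Ioo (0 : ℝ) 1) (hη : η ∈ Set.Ioo (0 : ℝ) 1)
    (hmax : 0 < αmax) (hinit : 0 < αinit) (h₀ : αinit ≤ α₀)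
    : P.ConvergesToSolutions x := by
  obtain ⟨xs, hxs⟩ := hP.X₁_nonempty
  obtain ⟨m, hm⟩ := exists_le_val₁ hP
  have hen := h.energyDecrease hP hσ hν hη hmax hinit h₀ hm hxs
  have hd := h.mem_dom hP hσ
  have hanti := h.gap_antitone hP hσ hν hη hmax hinit h₀ hm xs
  obtain ⟨K, hK⟩ := h.exists_norm_le hP hσ hν hη hmax hinit h₀
  obtain ⟨c, hc, hcα⟩ := h.exists_le_α hP hσ hν hη hmax hinit h₀ hK
  have hτ : ∀ k, 3 / 4 * c ≤ α (k + 2) * σ (k + 2) / σ (k + 1) := by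
    intro k
    rw [le_div_iff₀ (hσ.pos' _)]
    have h1 := (hσ.mem (k + 1)).1
    have h2 := hσ.pos' (k + 1)
    have h3 := mul_le_mul (hcα (k + 2)) h1 (by positivity) (hc.le.trans (hcα _))
    have h4 : α (k + 2) * σ (k + 1 + 1) = α (k + 2) * σ (k + 2) := rfl
    linarith
  have hc' : 0 < 3 / 4 * c := by positivity
  have hgap : Tendsto (fun k => P.gap m xs (σ (k + 1)) (x (k + 1))) atTop (𝓝 0) :=
    hen.tendsto_gap hP hm hxs (fun i j hij => hanti (Nat.succ_le_succ hij)) hc' hτ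
      (hσ.tendsto_zero.comp (tendsto_add_atTop_nat 1))
  have hsq : Tendsto (fun k => ‖x (k + 1) - x (k + 2)‖ ^ 2) atTop (𝓝 0) := by
    have h1 := hgap.const_mul (αmax / (1 - ν))
    rw [mul_zero] at h1
    exact squeeze_zero (fun k => by positivity)
      (fun k => h.sq_le_gap hP hσ hν hη hmax hinit h₀ hm hxs (k + 1)) h1
  have hnorm : Tendsto (fun k => ‖x (k + 1) - x (k + 2)‖) atTop (𝓝 0) := by
    have h1 := hsq.sqrt
    simpa [Real.sqrt_sq] using h1
  have hω : Tendsto (fun k => ‖x (k + 1) - x (k + 2)‖ + ‖x (k + 1) - x (k + 2)‖ ^ 2 / 4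
      + αmax * max 2 (α₀ / αinit) * P.gap m xs (σ (k + 1)) (x (k + 1))) atTop (𝓝 0) := by
    have h1 := (hnorm.add (hsq.div_const 4)).add (hgap.const_mul (αmax * max 2 (α₀ / αinit)))
    simpa using h1
  have hfin := hen.tendsto_infDist hP hxs hω
    (tendsto_val₂_of_gap hP (fun k => (hσ.pos' _).le) (fun k => hd (k + 1)) hm hxs hgap) hc' hτ
    (hσ.tendsto_sum_shift 1)
  exact .of_tendsto_infDist hP
    ((tendsto_add_atTop_iff_nat (f := fun k => Metric.infDist (x k) P.X₁) 1).1 hfin)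

end IsAdaBiM

end BilevelProblem

theorem mainTheorem2 {n : ℕ} (P : BilevelProblem n) (hP : P.BasicAssumption)
    (σ : ℕ → ℝ) (hσ : IsPenaltySeq σ) (ν : ℝ) (hν : ν ∈ Set.Ioo (0 : ℝ) 1) :
    (∀ (η αmax αinit α₀ : ℝ) (xinit : EuclideanSpace ℝ (Fin n)),
      η ∈ Set.Ioo (0 : ℝ) 1 → 0 < αmax → 0 < αinit → αinit ≤ α₀ →
        (∃ x α, P.IsAdaBiM η ν αmax σ xinit αinit α₀ x α) ∧
        ∀ x α, P.IsAdaBiM η ν αmax σ xinit αinit α₀ x α → P.ConvergesToSolutions x) ∧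
    (∀ (L₁ L₂ : ℝ≥0) (x₀ : EuclideanSpace ℝ (Fin n)),
      LipschitzWith L₁ (∇ P.f₁) → LipschitzWith L₂ (∇ P.f₂) → 0 < L₁ + L₂ →
        (∃ x, P.IsStaBiM ν L₁ L₂ σ x₀ x) ∧
        ∀ x, P.IsStaBiM ν L₁ L₂ σ x₀ x → P.ConvergesToSolutions x) := by
  refine ⟨fun η αmax αinit α₀ xinit hη hmax hinit h₀ => ⟨?_, fun x α h => ?_⟩,
    fun L₁ L₂ x₀ h₁ h₂ hL => ⟨?_, fun x h => ?_⟩⟩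
  · exact BilevelProblem.exists_isAdaBiM hP hσ hν hη hmax hinit (hinit.trans_le h₀) xinit
  · exact h.convergesToSolutions hP hσ hν hη hmax hinit h₀
  · exact BilevelProblem.exists_isStaBiM hP hσ hν.1 hL x₀
  · exact h.convergesToSolutions hP hσ hν h₁ h₂ hL
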